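/- **Setting.** Let $\mathfrak g$ be a finite-dimensional complex semisimple Lie algebra, $\mathfrak h\subset\mathfrak g$ a Cartan subalgebra, $\Delta$ the root system, $\{\alpha_1,\dots,\alpha_\ell\}$ a system of simple roots, $\mathfrak b=\mathfrak h\oplus\bigoplus_{\alpha>0}\mathfrak g_\alpha$ the corresponding Borel subalgebra, and $\mathfrak p\supseteq\mathfrak b$ a (standard) parabolic subalgebra. Let $I=\{i : \mathfrak g_{-\alpha_i}\not\subseteq\mathfrak p\}$, let $Z_1,\dots,Z_\ell\in\mathfrak h$ be the basis dual to the simple roots, and put $Z_S=\sum_{i\in S}Z_i$ for $S\subseteq\{1,\dots,\ell\}$ and $Z_S(\alpha)=\alpha(Z_S)$. Grade $\mathfrak g$ by $\mathfrak g_j=\{x:[Z_I,x]=jx\}$, $j\in\mathbb Z$. For a subspace $\mathfrak k\subseteq\mathfrak g$ let $\Delta(\mathfrak k)=\{\alpha\in\Delta:\mathfrak g_\alpha\subseteq\mathfrak k\}$. Let $\mu\in\mathfrak h^*$ be such that $-\mu$ is $\mathfrak p$-dominant, i.e. $\langle-\mu,\alpha_i^\vee\rangle$ is a nonnegative real number for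 all $i\notin I$. Put $$I_\mu=\{i\in I:\langle\mu,\alpha_i^\vee\rangle=0\},\qquad J_\mu=\{i\notin I:\langle\mu,\alpha_i^\vee\rangle\neq0\}.$$ Let $\mathbb V_\mu$ be an irreducible $\mathfrak g_0$-module with lowest weight $\mu$ and lowest weight vector $\phi_0\ne0$ (so $\mathfrak h$ acts on $\phi_0$ by $\mu$, and $\mathfrak g_{-\alpha}\phi_0=0$ for every positive root $\alpha$ with $\mathfrak g_{-\alpha}\subseteq\mathfrak g_0$). Let $\mathfrak a=\mathfrak a(\mu)=\bigoplus_j\mathfrak a_j$, where $\mathfrak a_j=\mathfrak g_j$ for $j<0$, $\mathfrak a_0=\{x\in\mathfrak g_0: x\cdot\phi_0=0\}$, and $\mathfrak a_j=\{x\in\mathfrak g_j:[x,\mathfrak g_{-1}]\subseteq\mathfrak a_{j-1}\}$ for $j>0$. **Theorem.** Suppose $I_\mu\neq\emptyset$. Then: (a) $\mathfrak a_1$ generates all $\mathfrak a_j$, $j\ge1$: one has $\mathfrak a_{j+1}=[\mathfrak a_1,\mathfrak a_j]$ for all $j\ge1$, and the Lie subalgebra generated by $\mathfrak a_1$ is $\mathfrak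 a_+=\bigoplus_{j\ge1}\mathfrak a_j$. (b) For every $j\ge1$, $\mathfrak a_j$ is the direct sum of the root spaces $\mathfrak g_\alpha$, $\alpha\in\Delta(\mathfrak a_j)$, and $$\Delta(\mathfrak a_j)=\{\alpha\in\Delta(\mathfrak g_j): Z_{I_\mu}(\alpha)=j,\ Z_{J_\mu}(\alpha)=0\}.$$ (c) (Reduced geometry.) Remove from the Dynkin diagram of $\mathfrak g$ all nodes in $I\setminus I_\mu$ and in $J_\mu$, with the edges at these nodes, and then all connected components of what is left that contain no node of $I_\mu$. Let $N$ be the set of remaining nodes, and let $(\overline{\mathfrak g},\overline{\mathfrak p})$ be a complex semisimple Lie algebra with a standard parabolic subalgebra whose Dynkin diagram is the resulting diagram on $N$ (its simple roots $\overline\alpha_i$, $i\in N$, have the same Cartan integers as the $\alpha_i$) with set of crossed nodes $I_\mu$. Then $\Delta(\mathfrak a_+)$ and $\Delta(\overline{\mathfrak g}_+)$ correspond: for all $j\ge1$ and all integers $m_1,\dots,m_\ell$, one has $\sum_i m_i\alpha_i\in\Delta(\mathfrak a_j)$ if and only if $m_i=0$ for all $i\notin N$ and $\sum_{i\in N}m_i\overline\alpha_i\in\Delta(\overline{\mathfrak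 g}_j)$. -/

import Mathlib

namespace ParabolicProlongation

open LieAlgebra LieAlgebra.IsKilling Module

noncomputable section

/-- A base (system of simple roots `Δ⁰`) of the root system of a complex semisimple Lie algebra `𝔤`
with respect to a Cartan subalgebra `H`. The simple roots are indexed by `b.support`. -/
abbrev SimpleRoots {𝔤 : Type*} [LieRing 𝔤] [LieAlgebra ℂ 𝔤] [FiniteDimensional ℂ 𝔤]
    [LieAlgebra.IsSemisimple ℂ 𝔤] (H : LieSubalgebra ℂ 𝔤) [H.IsCartanSubalgebra] : Type _ :=
  (rootSystem H).Base

section Graded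

variable {𝔤 : Type*} [LieRing 𝔤] [LieAlgebra ℂ 𝔤]

/-- The nonnegative part of the prolongation: `𝔞_0` is given and
`𝔞_{k+1} = {X ∈ 𝔤_{k+1} | [X, 𝔤_{-1}] ⊆ 𝔞_k}`. -/
def prolongationNonneg (gr : ℤ → Submodule ℂ 𝔤) (a0 : Submodule ℂ 𝔤) : ℕ → Submodule ℂ 𝔤
  | 0 => a0
  | k + 1 =>
    { carrier := {X | X ∈ gr ((k : ℤ) + 1) ∧ ∀ Y ∈ gr (-1), ⁅X, Y⁆ ∈ prolongationNonneg gr a0 k}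
      zero_mem' := ⟨Submodule.zero_mem _, fun Y _ => by
        rw [zero_lie]; exact Submodule.zero_mem _⟩
      add_mem' := fun hx hy => ⟨Submodule.add_mem _ hx.1 hy.1, fun Y hY => by
        rw [add_lie]; exact Submodule.add_mem _ (hx.2 Y hY) (hy.2 Y hY)⟩
      smul_mem' := fun c _ hx => ⟨Submodule.smul_mem _ c hx.1, fun Y hY => by
        rw [smul_lie]; exact Submodule.smul_mem _ c (hx.2 Y hY)⟩ }

/-- The graded pieces of the prolongation `pr^𝔤(𝔤_-, 𝔞_0)` of a subspace `𝔞_0` of `𝔤_0` inside a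
`ℤ`-graded Lie algebra `𝔤`: `𝔞_k = 𝔤_k` for `k < 0`, the given `𝔞_0` for `k = 0`, and
`𝔞_k = {X ∈ 𝔤_k | [X, 𝔤_{-1}] ⊆ 𝔞_{k-1}}` for `k > 0`. -/
def prolongation (gr : ℤ → Submodule ℂ 𝔤) (a0 : Submodule ℂ 𝔤) : ℤ → Submodule ℂ 𝔤
  | Int.ofNat k => prolongationNonneg gr a0 k
  | Int.negSucc k => gr (Int.negSucc k)

/-- The annihilator of a vector `φ` of a `𝔤_0`-module, viewed as a subspace of `𝔤`. -/
def annihilator (g0 : LieSubalgebra ℂ 𝔤) {V : Type*} [AddCommGroup V] [Module ℂ V]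
    [LieRingModule g0 V] [LieModule ℂ g0 V] (φ : V) : Submodule ℂ 𝔤 where
  carrier := {x | ∃ hx : x ∈ g0, ⁅(⟨x, hx⟩ : g0), φ⁆ = 0}
  zero_mem' := ⟨g0.zero_mem, zero_lie φ⟩
  add_mem' := by
    rintro x y ⟨hx, hx'⟩ ⟨hy, hy'⟩
    refine ⟨g0.add_mem hx hy, ?_⟩
    have h : (⟨x + y, g0.add_mem hx hy⟩ : g0) = ⟨x, hx⟩ + ⟨y, hy⟩ := rfl
    rw [h, add_lie, hx', hy', add_zero]
  smul_mem' := by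
    rintro c x ⟨hx, hx'⟩
    refine ⟨g0.smul_mem c hx, ?_⟩
    have h : (⟨c • x, g0.smul_mem c hx⟩ : g0) = c • ⟨x, hx⟩ := rfl
    rw [h, smul_lie, hx', smul_zero]

end Graded

section Roots

variable {𝔤 : Type*} [LieRing 𝔤] [LieAlgebra ℂ 𝔤] [FiniteDimensional ℂ 𝔤]
  [LieAlgebra.IsSemisimple ℂ 𝔤] {H : LieSubalgebra ℂ 𝔤} [H.IsCartanSubalgebra]

/-- The root space `𝔤_α`. -/
def rootSub (α : H.root) : Submodule ℂ 𝔤 := (rootSpace H (α.1 : H → ℂ)).toSubmodule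

/-- The root space `𝔤_{-α}`. -/
def negRootSub (α : H.root) : Submodule ℂ 𝔤 := (rootSpace H (-(α.1 : H → ℂ))).toSubmodule

/-- `Δ(𝔨)`: the roots whose root space lies in the subspace `𝔨`. -/
def rootsOf (H : LieSubalgebra ℂ 𝔤) [H.IsCartanSubalgebra] (k : Submodule ℂ 𝔤) : Set H.root :=
  {α | rootSub α ≤ k}

/-- The (underlying space of the) Borel subalgebra `𝔟 = 𝔥 ⊕ ⨁_{α > 0} 𝔤_α`. -/
def borel (b : SimpleRoots H) : Submodule ℂ 𝔤 :=
  H.toSubmodule ⊔ ⨆ (α : H.root) (_ : b.IsPos α), rootSub α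

open scoped Classical in
/-- `I_𝔭`: the crossed nodes of a standard parabolic subalgebra `𝔭 ⊇ 𝔟`, i.e. the simple roots
`α_i` with `𝔤_{-α_i} ⊄ 𝔭`. -/
def crossed (b : SimpleRoots H) (p : LieSubalgebra ℂ 𝔤) : Finset b.support :=
  Finset.univ.filter fun i => ¬ negRootSub (i : H.root) ≤ p.toSubmodule

/-- The element `Z_i ∈ 𝔥` of the basis of `𝔥` dual to the basis of simple roots of `𝔥^*`. -/
def Zi (b : SimpleRoots H) (i : b.support) : H :=
  (Module.evalEquiv ℂ H).symm (b.toWeightBasis.coord i)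

open scoped Classical in
lemma simpleRoot_Zi (b : SimpleRoots H) (i k : b.support) :
    (k : H.root).1 (Zi b i) = if k = i then 1 else 0 := by
  have h : b.toWeightBasis k (Zi b i) = b.toWeightBasis.coord i (b.toWeightBasis k) :=
    Module.apply_evalEquiv_symm_apply ℂ H _ _
  have h2 : b.toWeightBasis k (Zi b i) = (k : H.root).1 (Zi b i) := by
    rw [RootPairing.Base.toWeightBasis_apply]; rfl
  rw [← h2, h, Module.Basis.coord_apply, Module.Basis.repr_self, Finsupp.single_apply]

/-- `Z_S = ∑_{i ∈ S} Z_i`. For a root `α = ∑ m_i α_i` one has `Z_S(α) = ∑_{i ∈ S} m_i`. -/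
def Z (b : SimpleRoots H) (S : Finset b.support) : H := ∑ i ∈ S, Zi b i

/-- The graded piece `𝔤_j = {x | [Z_S, x] = j x}`; for `S = I_𝔭` this is the grading of `𝔤`
determined by `𝔭`. -/
def grading (b : SimpleRoots H) (S : Finset b.support) (j : ℤ) : Submodule ℂ 𝔤 :=
  Module.End.eigenspace (LieAlgebra.ad ℂ 𝔤 (Z b S : 𝔤)) (j : ℂ)

/-- The Lie subalgebra `𝔤_0` (the piece of degree `0` of the grading). -/
def levi (b : SimpleRoots H) (S : Finset b.support) : LieSubalgebra ℂ 𝔤 where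
  toSubmodule := grading b S 0
  lie_mem' := by
    intro x y hx hy
    have hx' : ⁅(Z b S : 𝔤), x⁆ = 0 := by simpa [grading] using hx
    have hy' : ⁅(Z b S : 𝔤), y⁆ = 0 := by simpa [grading] using hy
    have : ⁅(Z b S : 𝔤), ⁅x, y⁆⁆ = 0 := by rw [leibniz_lie, hx', hy', zero_lie, lie_zero, add_zero]
    simpa [grading] using this

/-- `r_i(λ) = ⟨λ, α_i^∨⟩`. -/
def weightCoeff (b : SimpleRoots H) (lam : Dual ℂ H) (i : b.support) : ℂ :=
  lam ((rootSystem H).coroot (i : H.root))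

/-- A weight `λ ∈ 𝔥^*` is `𝔭`-dominant if `⟨λ, α_i^∨⟩` is a nonnegative real number for every
uncrossed node `i`. -/
def IsDominant (b : SimpleRoots H) (I : Finset b.support) (lam : Dual ℂ H) : Prop :=
  ∀ i, i ∉ I → 0 ≤ (weightCoeff b lam i).re ∧ (weightCoeff b lam i).im = 0

open scoped Classical in
/-- `I_μ = {i ∈ I | ⟨μ, α_i^∨⟩ = 0}`. -/
def Imu (b : SimpleRoots H) (I : Finset b.support) (μ : Dual ℂ H) : Finset b.support :=
  I.filter fun i => weightCoeff b μ i = 0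

open scoped Classical in
/-- `J_μ = {i ∉ I | ⟨μ, α_i^∨⟩ ≠ 0}`. -/
def Jmu (b : SimpleRoots H) (I : Finset b.support) (μ : Dual ℂ H) : Finset b.support :=
  Finset.univ.filter fun i => i ∉ I ∧ weightCoeff b μ i ≠ 0

/-- `φ` is a lowest weight vector of weight `μ` in a `𝔤_0`-module: it is nonzero, `𝔥` acts on it
through `μ`, and it is killed by the root spaces `𝔤_{-α} ⊆ 𝔤_0` with `α` positive. -/
structure IsLowestWeightVector (b : SimpleRoots H) (I : Finset b.support) (μ : Dual ℂ H)
    {V : Type*} [AddCommGroup V] [Module ℂ V] [LieRingModule (levi b I) V]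
    [LieModule ℂ (levi b I) V] (φ : V) : Prop where
  ne_zero : φ ≠ 0
  weight : ∀ (h : H) (hh : (h : 𝔤) ∈ levi b I), ⁅(⟨h, hh⟩ : levi b I), φ⁆ = μ h • φ
  lowest : ∀ α : H.root, b.IsPos α → ∀ (x : 𝔤) (hx : x ∈ levi b I), x ∈ negRootSub α →
    ⁅(⟨x, hx⟩ : levi b I), φ⁆ = 0

/-- The graded pieces of `𝔞(μ) = pr^𝔤(𝔤_-, 𝔞𝔫𝔫(φ))`, where `φ` is the lowest weight vector of
the irreducible `𝔤_0`-module of lowest weight `μ`. -/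
def tanaka (b : SimpleRoots H) (I : Finset b.support)
    {V : Type*} [AddCommGroup V] [Module ℂ V] [LieRingModule (levi b I) V]
    [LieModule ℂ (levi b I) V] (φ : V) : ℤ → Submodule ℂ 𝔤 :=
  prolongation (grading b I) (annihilator (levi b I) φ)

/-- The graph underlying the Dynkin diagram: distinct nodes are joined iff `c_{ij} c_{ji} ≠ 0`. -/
def dynkinGraph (b : SimpleRoots H) : SimpleGraph b.support where
  Adj i j := i ≠ j ∧ b.cartanMatrix i j * b.cartanMatrix j i ≠ 0
  symm := ⟨fun i j h => ⟨h.1.symm, by rw [mul_comm]; exact h.2⟩⟩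
  loopless := ⟨fun _ h => h.1 rfl⟩

/-- The nodes that survive the removal of `I \ I_μ` and of `J_μ`. -/
def keptNodes (b : SimpleRoots H) (I : Finset b.support) (μ : Dual ℂ H) : Set b.support :=
  {i | ¬ (i ∈ I ∧ i ∉ Imu b I μ) ∧ i ∉ Jmu b I μ}

/-- The nodes of the Dynkin diagram of the reduced geometry: those kept nodes whose connected
component, in the diagram left after the removal of `I \ I_μ` and `J_μ`, contains a node
of `I_μ`. -/
def reducedNodes (b : SimpleRoots H) (I : Finset b.support) (μ : Dual ℂ H) : Set b.support :=
  {i | ∃ (hi : i ∈ keptNodes b I μ) (k : b.support) (hk : k ∈ keptNodes b I μ),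
    k ∈ Imu b I μ ∧ ((dynkinGraph b).induce (keptNodes b I μ)).Reachable ⟨i, hi⟩ ⟨k, hk⟩}

/-- `(𝔤', 𝔭')` is the reduced geometry of `(𝔤, 𝔭, μ)`: `e` identifies the nodes of the
Dynkin diagram of `𝔤'` with the nodes in `reducedNodes`, it preserves the Cartan integers, and the
crossed nodes of `𝔭'` are those in `I_μ`. -/
structure IsReducedGeometry (b : SimpleRoots H) (I : Finset b.support) (μ : Dual ℂ H)
    {𝔤' : Type*} [LieRing 𝔤'] [LieAlgebra ℂ 𝔤'] [FiniteDimensional ℂ 𝔤']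
    [LieAlgebra.IsSemisimple ℂ 𝔤'] {H' : LieSubalgebra ℂ 𝔤'} [H'.IsCartanSubalgebra]
    (b' : SimpleRoots H') (p' : LieSubalgebra ℂ 𝔤')
    (e : b'.support ≃ reducedNodes b I μ) : Prop where
  borel_le : borel b' ≤ p'.toSubmodule
  cartanMatrix_eq : ∀ i k, b'.cartanMatrix i k = b.cartanMatrix (e i).1 (e k).1
  crossed_iff : ∀ i, i ∈ crossed b' p' ↔ (e i).1 ∈ Imu b I μ

end Roots

end

end ParabolicProlongation

open LieAlgebra LieAlgebra.IsKilling Module ParabolicProlongation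

/-! Each 𝔞_j with j ≥ 1 is stable under the Cartan subalgebra, hence a sum of root spaces.
Everything reduces to deciding which roots of degree j occur in it. The answer is `IsReducedRoot`: α
has no coefficient on I \ I_μ or on J_μ.

Such roots do occur (`rootSub_le_prolongationNonneg`). Subtracting a root of degree 1 from a reduced
root of degree at least 2 leaves a reduced root, so induction leads down to degree 1. There a
bracket with 𝔤_{-1} is a multiple of a coroot on which μ vanishes, or a root vector of 𝔤_0 that
kills φ. The representation-theoretic input is `eq_zero_of_weight_add_simpleRoot`: if i ∉ I and ⟨μ,
α_i^∨⟩ = 0, then e_i φ = 0, since otherwise e_i φ would generate a nonzero submodule not containing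
φ.

Conversely, let α be a root of 𝔞_1. Then [𝔤_α, 𝔤_{-α}] ⊆ 𝔞_0 forces μ(α^∨) = 0. Lowering α by
negative roots of 𝔤_0 reaches its only simple root in I, which therefore lies in I_μ. In μ(α^∨) = 0
the remaining terms have one sign by dominance, so the coefficients on J_μ vanish. A root of higher
degree splits into roots of 𝔞_1 and 𝔞_{j-1} (`exists_root_eq_add_of_rootSub_le`).

This splitting, with [𝔤_β, 𝔤_γ] ≠ 0 whenever β + γ is a root, gives generation by 𝔞_1. For the
reduced geometry, supports of roots are connected (`reachable_of_coeff_ne_zero`), and the Cartan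
integers determine which integral combinations are roots
(`IsPos.exists_root_eq_sum_of_cartanMatrix_eq`). -/

namespace RootPairing.Base

/-! ### Integer coefficients of roots with respect to a base. -/

open Function Module

variable {ι R M N : Type*} [CommRing R] [CharZero R] [AddCommGroup M] [Module R M]
  [AddCommGroup N] [Module R N] {P : RootPairing ι R M N} (b : P.Base)

/-- The integer coefficients of a root with respect to a base. -/
noncomputable def coeff (i : ι) (j : b.support) : ℤ :=
  (b.exists_root_eq_sum_int i).choose j

lemma root_eq_sum_coeff (i : ι) : P.root i = ∑ j : b.support, b.coeff i j • P.root j := by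
  conv_lhs => rw [(b.exists_root_eq_sum_int i).choose_spec.2.2]
  exact (Finset.sum_coe_sort b.support
    (fun j => (b.exists_root_eq_sum_int i).choose j • P.root j)).symm

lemma coroot_eq_sum_coeff_flip (i : ι) :
    P.coroot i = ∑ j : b.support, b.flip.coeff i j • P.coroot j :=
  b.flip.root_eq_sum_coeff i

lemma eq_of_sum_smul_root_eq {f g : b.support → ℤ}
    (h : ∑ j, f j • P.root j = ∑ j, g j • P.root j) : f = g :=
  funext <| Fintype.linearIndependent_iffₛ.mp (b.linearIndepOn_root.restrict_scalars' ℤ) f g h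

variable {b} in
lemma coeff_eq_of_root_eq_sum {i : ι} {f : b.support → ℤ}
    (h : P.root i = ∑ j, f j • P.root j) : b.coeff i = f :=
  b.eq_of_sum_smul_root_eq <| by rw [← h, ← root_eq_sum_coeff]

variable {b} in
lemma coeff_add {i j k : ι} (h : P.root k = P.root i + P.root j) :
    b.coeff k = b.coeff i + b.coeff j :=
  coeff_eq_of_root_eq_sum <| by
    simp only [Pi.add_apply, add_smul, Finset.sum_add_distrib, ← root_eq_sum_coeff, h]

variable {b} in
lemma coeff_neg {i k : ι} (h : P.root k = -P.root i) : b.coeff k = -b.coeff i :=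
  coeff_eq_of_root_eq_sum <| by
    simp only [Pi.neg_apply, neg_smul, Finset.sum_neg_distrib, ← root_eq_sum_coeff, h]

lemma coeff_of_support [DecidableEq b.support] (j : b.support) : b.coeff j = Pi.single j 1 :=
  coeff_eq_of_root_eq_sum <| by
    rw [Finset.sum_eq_single j (fun k _ hk => by simp [hk]) (by simp)]; simp

lemma height_eq_sum_coeff (i : ι) : b.height i = ∑ j, b.coeff i j := by
  rw [height]
  exact (Finset.sum_coe_sort b.support (fun j => (b.exists_root_eq_sum_int i).choose j)).symm

lemma coeff_nonneg_or_nonpos (i : ι) : (∀ j, 0 ≤ b.coeff i j) ∨ ∀ j, b.coeff i j ≤ 0 :=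
  (b.exists_root_eq_sum_int i).choose_spec.2.1.imp (fun h j => h.le j) (fun h j => h.le j)

variable {b} in
lemma IsPos.coeff_nonneg {i : ι} (h : b.IsPos i) (j : b.support) : 0 ≤ b.coeff i j := by
  rcases b.coeff_nonneg_or_nonpos i with h' | h'
  · exact h' j
  · rw [isPos_iff, height_eq_sum_coeff] at h
    exact absurd (Finset.sum_nonpos fun j _ => h' j) h.not_ge

variable {b} in
lemma isPos_of_coeff_pos {i : ι} {j : b.support} (h : 0 < b.coeff i j) : b.IsPos i := by
  rcases b.coeff_nonneg_or_nonpos i with h' | h'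
  · rw [isPos_iff', height_eq_sum_coeff]
    exact Finset.sum_nonneg fun j _ => h' j
  · exact absurd (h' j) h.not_ge

lemma exists_coeff_ne_zero (i : ι) : ∃ j, b.coeff i j ≠ 0 := by
  by_contra! h
  exact P.ne_zero i (by rw [b.root_eq_sum_coeff i]; simp [h])

lemma pairingIn_eq_sum [P.IsCrystallographic] {κ : Type*} [Fintype κ] (f : κ → ι) (m : κ → ℤ)
    {i : ι} (h : P.root i = ∑ k, m k • P.root (f k)) (j : ι) :
    P.pairingIn ℤ i j = ∑ k, m k * P.pairingIn ℤ (f k) j := by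
  apply FaithfulSMul.algebraMap_injective ℤ R
  simp_rw [map_sum, map_mul, algebraMap_pairingIn, ← root_coroot_eq_pairing, h, map_sum,
    map_zsmul, LinearMap.coe_sum, Finset.sum_apply, LinearMap.smul_apply, zsmul_eq_mul]
  rfl

lemma sum_add_mul_single_smul {κ A : Type*} [Fintype κ] [DecidableEq κ] [AddCommGroup A]
    (v : κ → A) (m : κ → ℤ) (d : ℤ) (l : κ) :
    ∑ k, (m k + d * (Pi.single l 1 : κ → ℤ) k) • v k = ∑ k, m k • v k + d • v l := by
  simp only [add_smul, Finset.sum_add_distrib]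
  congr 1
  rw [Finset.sum_eq_single l (fun k _ hk => by simp [hk]) (by simp)]
  simp

/-! ### Coefficients of coroots, and roots determined by Cartan integers. -/

section Finite

variable [Finite ι] [P.IsCrystallographic]

/-- Up to positive integer factors depending on the roots involved, a coroot has the same
coefficients as the corresponding root. -/
lemma exists_pos_mul_coeff_flip_eq :
    ∃ q : ι → ℤ, (∀ i, 0 < q i) ∧
      ∀ i (j : b.support), q i * b.flip.coeff i j = q j * b.coeff i j := by
  have _i : Fintype ι := Fintype.ofFinite ι
  -- The squared length (α, α): the vector (α, α) α^∨ depends linearly on α, being twice the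
  -- polarization.
  let q (i : ι) : ℤ := P.RootFormIn ℤ (P.rootSpanMem ℤ i) (P.rootSpanMem ℤ i)
  have hq (i : ι) : q i • P.coroot i = 2 • P.Polarization (P.root i) := by
    have h := P.rootFormIn_self_smul_coroot ℤ i
    rw [PolarizationIn_eq] at h
    exact h
  refine ⟨q, fun i => ?_, fun i => ?_⟩
  · simpa only [q, ← posRootForm_eq] using RootPositiveForm.zero_lt_posForm_apply_root _ _
  · have key : ∑ j : b.support, (q i * b.flip.coeff i j) • P.coroot j =
        ∑ j : b.support, (q j * b.coeff i j) • P.coroot j := by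
      have h1 : ∑ j : b.support, (q i * b.flip.coeff i j) • P.coroot j = q i • P.coroot i := by
        rw [b.coroot_eq_sum_coeff_flip i, Finset.smul_sum]
        simp only [mul_smul]
      rw [h1, hq, b.root_eq_sum_coeff i, map_sum, Finset.smul_sum]
      refine Finset.sum_congr rfl fun j _ => ?_
      rw [map_zsmul, smul_comm, ← hq, smul_smul, mul_comm]
    exact congrFun (b.flip.eq_of_sum_smul_root_eq key)

variable {b} in
lemma coeff_flip_eq_zero_iff {i : ι} {j : b.support} :
    b.flip.coeff i j = 0 ↔ b.coeff i j = 0 := by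
  obtain ⟨q, hq, h⟩ := b.exists_pos_mul_coeff_flip_eq
  have := h i j
  constructor <;> intro h0
  · simpa [h0, (hq j).ne'] using this.symm
  · simpa [h0, (hq i).ne'] using this

variable {b} in
lemma IsPos.coeff_flip_nonneg {i : ι} (hi : b.IsPos i) (j : b.support) :
    0 ≤ b.flip.coeff i j := by
  obtain ⟨q, hq, h⟩ := b.exists_pos_mul_coeff_flip_eq
  have h1 : 0 ≤ q i * b.flip.coeff i j := by
    rw [h i j]; exact mul_nonneg (hq _).le (hi.coeff_nonneg j)
  exact nonneg_of_mul_nonneg_right h1 (hq i)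

/-- If two root systems have families of simple roots with the same Cartan integers, then the
same integral combinations of these simple roots are positive roots. -/
lemma IsPos.exists_root_eq_sum_of_cartanMatrix_eq [IsDomain R] [P.IsReduced]
    {ι' R' M' N' : Type*} [CommRing R'] [CharZero R'] [AddCommGroup M'] [Module R' M']
    [AddCommGroup N'] [Module R' N'] {P' : RootPairing ι' R' M' N'}
    [Finite ι'] [IsDomain R'] [P'.IsCrystallographic] {b : P.Base} (b' : P'.Base)
    {κ : Type*} [Fintype κ] (f : κ → b.support) (hf : Injective f) (f' : κ → b'.support)
    (h : ∀ k l, b.cartanMatrix (f k) (f l) = b'.cartanMatrix (f' k) (f' l))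
    {i : ι} (hi : b.IsPos i) (m : κ → ℤ) (hm : P.root i = ∑ k, m k • P.root (f k)) :
    ∃ i', P'.root i' = ∑ k, m k • P'.root (f' k) := by
  classical
  generalize hn : (b.height i).natAbs = n
  -- Induction on height: reflect in a simple root to lower the height, transport the smaller root,
  -- and reflect back in the other root system.
  induction n using Nat.strongRecOn generalizing i m with
  | ind n ih =>
    have hcoeff : b.coeff i = Function.extend f m 0 := by
      refine coeff_eq_of_root_eq_sum ?_
      rw [hm]
      exact Fintype.sum_of_injective f hf _ _
        (fun j hj => by rw [extend_apply' _ _ _ (by simpa using hj)]; simp)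
        (fun k => by rw [hf.extend_apply])
    have hm0 (k : κ) : 0 ≤ m k := by
      have := hi.coeff_nonneg (f k)
      rwa [hcoeff, hf.extend_apply] at this
    obtain ⟨j, hj, hji⟩ := hi.exists_mem_support_pos_pairingIn
    rw [P.zero_lt_pairingIn_iff'] at hji
    -- A simple root outside the family pairs nonpositively with each member, hence with the whole
    -- nonnegative combination.
    obtain ⟨l, hl⟩ : ∃ l, f l = ⟨j, hj⟩ := by
      by_contra! hne
      refine absurd (Finset.sum_nonpos fun k _ => ?_)
        ((pairingIn_eq_sum (fun k => (f k : ι)) m hm j) ▸ hji).not_ge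
      exact mul_nonpos_of_nonneg_of_nonpos (hm0 k)
        (b.cartanMatrix_le_zero_of_ne (f k) ⟨j, hj⟩ (hne k))
    rcases eq_or_ne i j with rfl | hij
    · have : m = Pi.single l 1 := by
        funext k
        have h1 := congrFun hcoeff (f k)
        have h2 := congrFun (b.coeff_of_support ⟨i, hj⟩) (f k)
        rw [hf.extend_apply] at h1
        rw [← h1, h2, ← hl]
        simp [Pi.single_apply, hf.eq_iff]
      refine ⟨f' l, ?_⟩
      rw [this, Finset.sum_eq_single l (fun k _ hk => by simp [hk]) (by simp)]; simp
    · have hk := hi.reflectionPerm hj hij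
      have hroot : P.root (P.reflectionPerm j i) =
          P.root i + (-P.pairingIn ℤ i j) • P.root j := by
        rw [root_reflectionPerm, neg_smul, reflection_apply_root' ℤ, sub_eq_add_neg]
      have hlt : (b.height (P.reflectionPerm j i)).natAbs < n := by
        have h1 := b.height_add_zsmul hroot
        rw [height_one_of_mem_support hj] at h1
        rw [isPos_iff] at hk
        simp only [smul_eq_mul, mul_one] at h1
        lia
      set c := P.pairingIn ℤ i j with hc
      have hm' : P.root (P.reflectionPerm j i) =
          ∑ k, (m k + (-c) * (Pi.single l 1 : κ → ℤ) k) • P.root (f k) := by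
        rw [hroot, hm, sum_add_mul_single_smul (fun k => P.root (f k)), hl]
      obtain ⟨i', hi'⟩ := ih _ hlt hk _ hm' rfl
      -- Pairings with simple coroots depend only on coefficients and Cartan integers, so the return
      -- reflection shifts by the same integer.
      have hpair : P'.pairingIn ℤ i' (f' l) = -c := by
        have h2 : P.pairingIn ℤ (P.reflectionPerm j i) j = -c := by
          rw [← pairingIn_reflectionPerm, pairingIn_reflectionPerm_self_right]
        rw [pairingIn_eq_sum (fun k => (f k : ι)) _ hm' j] at h2
        refine (pairingIn_eq_sum (fun k => (f' k : ι')) _ hi' (f' l)).trans (Eq.trans ?_ h2)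
        refine Finset.sum_congr rfl fun k _ => ?_
        have := h k l
        rw [hl] at this
        exact congrArg _ this.symm
      refine ⟨P'.reflectionPerm (f' l) i', ?_⟩
      rw [root_reflectionPerm, reflection_apply_root' ℤ, hpair, hi',
        sum_add_mul_single_smul (fun k => P'.root (f' k))]
      module

end Finite

end RootPairing.Base

namespace ParabolicProlongation

open LieAlgebra LieAlgebra.IsKilling LieModule Module

noncomputable section

lemma lie_mem_of_mem_iSup {𝔤 : Type*} [LieRing 𝔤] [LieAlgebra ℂ 𝔤] {κ κ' : Type*}
    {A : κ → Submodule ℂ 𝔤} {B : κ' → Submodule ℂ 𝔤}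
    {K : Submodule ℂ 𝔤} (h : ∀ i j, ∀ x ∈ A i, ∀ y ∈ B j, ⁅x, y⁆ ∈ K) {x y : 𝔤}
    (hx : x ∈ ⨆ i, A i) (hy : y ∈ ⨆ j, B j) : ⁅x, y⁆ ∈ K := by
  have h1 (i) (x) (hx : x ∈ A i) : ⁅x, y⁆ ∈ K :=
    (iSup_le fun j y hy => h i j x hx y hy : ⨆ j, B j ≤ K.comap (ad ℂ 𝔤 x : 𝔤 →ₗ[ℂ] 𝔤)) hy
  exact (iSup_le fun i x hx => h1 i x hx :
    ⨆ i, A i ≤ K.comap ((ad ℂ 𝔤 : 𝔤 →ₗ[ℂ] End ℂ 𝔤).flip y)) hx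

variable {𝔤 : Type*} [LieRing 𝔤] [LieAlgebra ℂ 𝔤] [FiniteDimensional ℂ 𝔤]
  [LieAlgebra.IsSemisimple ℂ 𝔤] {H : LieSubalgebra ℂ 𝔤} [H.IsCartanSubalgebra]

/-! ### Root spaces and their brackets. -/

section RootSpaces

lemma lie_eq_smul_of_mem_rootSub {α : H.root} {x : 𝔤} (hx : x ∈ rootSub α) (h : H) :
    ⁅(h : 𝔤), x⁆ = α.1 h • x :=
  lie_eq_smul_of_mem_rootSpace hx h

lemma rootSub_isAtom (α : H.root) : IsAtom (rootSub α) :=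
  Submodule.isAtom_iff_finrank_eq_one.mpr
    (finrank_rootSpace_eq_one α.1 (LieSubalgebra.isNonZero_coe_root α))

lemma exists_ne_zero_mem_rootSub (α : H.root) : ∃ x ∈ rootSub α, x ≠ 0 :=
  (Submodule.ne_bot_iff _).mp (rootSub_isAtom α).1

/-- Root spaces are lines, so a single nonzero vector decides containment. This turns statements
about subspaces into statements about roots. -/
lemma rootSub_le_of_mem {α : H.root} {K : Submodule ℂ 𝔤} {x : 𝔤} (hx : x ∈ rootSub α)
    (hx0 : x ≠ 0) (hxK : x ∈ K) : rootSub α ≤ K := by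
  by_contra h
  have := (rootSub_isAtom α).not_le_iff_disjoint.mp h
  exact hx0 (Submodule.disjoint_def.mp this x hx hxK)

lemma exists_smul_eq_of_mem_rootSub {α : H.root} {x y : 𝔤} (hx : x ∈ rootSub α)
    (hx0 : x ≠ 0) (hy : y ∈ rootSub α) : ∃ c : ℂ, c • x = y :=
  Submodule.mem_span_singleton.mp
    (rootSub_le_of_mem hx hx0 (Submodule.mem_span_singleton_self x) hy)

/-- The root `-α`. -/
def negRoot (α : H.root) : H.root :=
  ⟨-α.1, by simpa using LieSubalgebra.isNonZero_coe_root α⟩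

lemma root_negRoot (α : H.root) :
    (rootSystem H).root (negRoot α) = -(rootSystem H).root α := rfl

lemma rootSub_negRoot (α : H.root) : rootSub (negRoot α) = negRootSub α := rfl

lemma root_apply_eq {α β γ : H.root}
    (h : (rootSystem H).root γ = (rootSystem H).root α + (rootSystem H).root β) :
    ((γ.1 : Weight ℂ H 𝔤) : H → ℂ) = (α.1 : H → ℂ) + (β.1 : H → ℂ) :=
  funext fun x => LinearMap.congr_fun h x

lemma lie_mem_rootSub {α β γ : H.root}
    (h : (rootSystem H).root γ = (rootSystem H).root α + (rootSystem H).root β)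
    {x y : 𝔤} (hx : x ∈ rootSub α) (hy : y ∈ rootSub β) : ⁅x, y⁆ ∈ rootSub γ := by
  have := lie_mem_genWeightSpace_of_mem_genWeightSpace hx hy
  rw [← root_apply_eq h] at this
  exact this

lemma lie_eq_zero_of_add_ne {α β : H.root}
    (h0 : (rootSystem H).root α + (rootSystem H).root β ≠ 0)
    (h : ∀ γ, (rootSystem H).root γ ≠ (rootSystem H).root α + (rootSystem H).root β)
    {x y : 𝔤} (hx : x ∈ rootSub α) (hy : y ∈ rootSub β) : ⁅x, y⁆ = 0 := by
  by_contra hne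
  have hmem : ⁅x, y⁆ ∈ rootSpace H ((α.1 : H → ℂ) + (β.1 : H → ℂ)) :=
    lie_mem_genWeightSpace_of_mem_genWeightSpace hx hy
  have hbot : rootSpace H ((α.1 : H → ℂ) + (β.1 : H → ℂ)) ≠ ⊥ := fun h' => by
    exact hne <| (LieSubmodule.mem_bot _).mp (h' ▸ hmem)
  let γ : Weight ℂ H 𝔤 := ⟨_, hbot⟩
  have hγ : γ.toLinear = (rootSystem H).root α + (rootSystem H).root β := by
    ext x; rfl
  have hγ0 : γ.IsNonZero := fun h1 => h0 <| by
    rw [← hγ]; ext x; exact congrFun h1 x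
  exact h ⟨γ, by simpa using hγ0⟩ hγ

/-- By 𝔰𝔩₂-theory for α: 𝔤_β is spanned by f^q z, where z is a highest weight vector of the α-string
through β, and e f^q z is a nonzero multiple of f^{q-1} z. -/
lemma lie_ne_zero_of_root_eq_add {α β γ : H.root}
    (h : (rootSystem H).root γ = (rootSystem H).root α + (rootSystem H).root β)
    {x y : 𝔤} (hx : x ∈ rootSub α) (hx0 : x ≠ 0) (hy : y ∈ rootSub β) (hy0 : y ≠ 0) :
    ⁅x, y⁆ ≠ 0 := by
  have hα := LieSubalgebra.isNonZero_coe_root α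
  obtain ⟨h', e, f, t, he, hf⟩ := exists_isSl2Triple_of_weight_isNonZero hα
  obtain ⟨z, hz, hz0⟩ := (chainTop α.1 β.1).exists_ne_zero
  obtain rfl := t.h_eq_coroot hα he hf
  have prim : t.HasPrimitiveVectorWith z (chainLength α.1 β.1 : ℂ) :=
    have := lie_mem_genWeightSpace_of_mem_genWeightSpace he hz
    ⟨hz0, (chainLength_smul _ _ hz).symm, by rwa [genWeightSpace_add_chainTop _ _ hα] at this⟩
  set q := chainTopCoeff α.1 β.1 with hq
  -- Since α + β is a root, β is not at the top of its string.
  have hq1 : 1 ≤ q := by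
    have := (rootSpace_zsmul_add_ne_bot_iff α.1 β.1 hα 1).mp (by
      rw [one_smul, ← root_apply_eq h]; exact γ.1.genWeightSpace_ne_bot)
    exact_mod_cast this.1
  have hqn : q ≤ chainLength α.1 β.1 := chainTopCoeff_le_chainLength α.1 β.1
  have hmem : ((toEnd ℂ 𝔤 𝔤 f) ^ q) z ∈ rootSub β := by
    have := toEnd_pow_apply_mem hf hz q
    rw [coe_chainTop'] at this
    have h2 : q • (-(α.1 : H → ℂ)) + (q • (α.1 : H → ℂ) + (β.1 : H → ℂ)) = β.1 := by
      rw [smul_neg, neg_add_cancel_left]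
    rw [h2] at this
    exact this
  have hne := prim.pow_toEnd_f_ne_zero_of_eq_nat rfl hqn
  obtain ⟨c, hc⟩ := exists_smul_eq_of_mem_rootSub hx hx0 (y := e) he
  obtain ⟨d, hd⟩ := exists_smul_eq_of_mem_rootSub hy hy0 hmem
  intro hxy
  obtain ⟨r, hr⟩ : ∃ r, q = r + 1 := ⟨q - 1, by lia⟩
  -- The scalar is (r + 1)(n - r), with n the string length and r + 1 = q ≤ n, so it does not
  -- vanish.
  have key := prim.lie_e_pow_succ_toEnd_f r
  rw [← hr, ← hc, ← hd, smul_lie, lie_smul, hxy, smul_zero, smul_zero] at key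
  have hr0 := prim.pow_toEnd_f_ne_zero_of_eq_nat rfl (i := r) (by lia)
  rcases smul_eq_zero.mp key.symm with h1 | h1
  · rcases mul_eq_zero.mp h1 with h2 | h2
    · exact Nat.cast_add_one_ne_zero r h2
    · rw [sub_eq_zero] at h2
      have : chainLength α.1 β.1 = r := by exact_mod_cast h2
      lia
  · exact hr0 h1

lemma rootSub_le_of_lie_mem {α β γ : H.root}
    (h : (rootSystem H).root γ = (rootSystem H).root α + (rootSystem H).root β)
    {K : Submodule ℂ 𝔤} (hK : ∀ x ∈ rootSub α, ∀ y ∈ rootSub β, ⁅x, y⁆ ∈ K) :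
    rootSub γ ≤ K := by
  obtain ⟨x, hx, hx0⟩ := exists_ne_zero_mem_rootSub α
  obtain ⟨y, hy, hy0⟩ := exists_ne_zero_mem_rootSub β
  exact rootSub_le_of_mem (lie_mem_rootSub h hx hy) (lie_ne_zero_of_root_eq_add h hx hx0 hy hy0)
    (hK x hx y hy)

/-- If a sum of three roots is a root, and the first is not opposite to any of the other two, then
one of the partial sums involving the first is a root. -/
lemma exists_root_eq_add_or_of_add_add {α β γ δ ε : H.root}
    (hδ : (rootSystem H).root δ = (rootSystem H).root β + (rootSystem H).root γ)
    (hε : (rootSystem H).root ε = (rootSystem H).root α + (rootSystem H).root δ)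
    (hβ : (rootSystem H).root α + (rootSystem H).root β ≠ 0)
    (hγ : (rootSystem H).root α + (rootSystem H).root γ ≠ 0) :
    (∃ ζ, (rootSystem H).root ζ = (rootSystem H).root α + (rootSystem H).root β) ∨
      ∃ ζ, (rootSystem H).root ζ = (rootSystem H).root α + (rootSystem H).root γ := by
  by_contra! hcon
  obtain ⟨x, hx, hx0⟩ := exists_ne_zero_mem_rootSub α
  obtain ⟨y, hy, hy0⟩ := exists_ne_zero_mem_rootSub β
  obtain ⟨z, hz, hz0⟩ := exists_ne_zero_mem_rootSub γ
  -- If neither partial sum is a root, the Jacobi identity makes the nonzero double bracket vanish.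
  refine lie_ne_zero_of_root_eq_add hε hx hx0 (lie_mem_rootSub hδ hy hz)
    (lie_ne_zero_of_root_eq_add hδ hy hy0 hz hz0) ?_
  rw [leibniz_lie, lie_eq_zero_of_add_ne hβ hcon.1 hx hy,
    lie_eq_zero_of_add_ne hγ hcon.2 hx hz, zero_lie, lie_zero, add_zero]

lemma exists_lie_eq_coroot (α : H.root) :
    ∃ x ∈ rootSub α, ∃ y ∈ rootSub (negRoot α), ⁅x, y⁆ = ((rootSystem H).coroot α : 𝔤) := by
  have hα := LieSubalgebra.isNonZero_coe_root α
  obtain ⟨h', e, f, t, he, hf⟩ := exists_isSl2Triple_of_weight_isNonZero hα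
  exact ⟨e, he, f, hf, t.lie_e_f.trans (t.h_eq_coroot hα he hf)⟩

lemma exists_lie_eq_smul_coroot {α β : H.root}
    (h : (rootSystem H).root β = -(rootSystem H).root α) {x y : 𝔤} (hx : x ∈ rootSub α)
    (hy : y ∈ rootSub β) : ∃ c : ℂ, ⁅x, y⁆ = c • ((rootSystem H).coroot α : 𝔤) := by
  have hβ : β = negRoot α := (rootSystem H).root.injective (h.trans (root_negRoot α).symm)
  subst hβ
  obtain ⟨e, he, f, hf, hef⟩ := exists_lie_eq_coroot α
  have hne : ((rootSystem H).coroot α : 𝔤) ≠ 0 := by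
    simp
  obtain ⟨a, rfl⟩ := exists_smul_eq_of_mem_rootSub he (fun h0 => hne (by rw [← hef, h0, zero_lie])) hx
  obtain ⟨b, rfl⟩ := exists_smul_eq_of_mem_rootSub hf (fun h0 => hne (by rw [← hef, h0, lie_zero])) hy
  exact ⟨a * b, by rw [smul_lie, lie_smul, hef, smul_smul]⟩

/-- A subspace stable under the Cartan subalgebra is the sum of its intersection with the Cartan
subalgebra and of the root spaces it contains. -/
lemma le_inf_sup_iSup_rootSub {K : Submodule ℂ 𝔤}
    (hK : ∀ h : H, ∀ x ∈ K, ⁅(h : 𝔤), x⁆ ∈ K) :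
    K ≤ (K ⊓ H.toSubmodule) ⊔ ⨆ α ∈ rootsOf H K, rootSub α := by
  let N : LieSubmodule ℂ H 𝔤 := { K with lie_mem := fun {h m} hm => hK h m hm }
  have hN := eq_iSup_inf_genWeightSpace ℂ H 𝔤 N
  have hN' : K = ⨆ χ : Weight ℂ H 𝔤, K ⊓ (rootSpace H (χ : H → ℂ)).toSubmodule := by
    have := congrArg LieSubmodule.toSubmodule hN
    rwa [LieSubmodule.iSup_toSubmodule] at this
  conv_lhs => rw [hN']
  refine iSup_le fun χ => ?_
  by_cases hχ : χ.IsZero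
  · refine le_sup_of_le_left ?_
    rw [hχ, rootSpace_zero_eq]
    exact le_rfl
  · let α : H.root := ⟨χ, by simpa using hχ⟩
    refine le_sup_of_le_right ?_
    rintro x ⟨hxK, hx⟩
    rcases eq_or_ne x 0 with rfl | hx0
    · exact Submodule.zero_mem _
    · have hα : α ∈ rootsOf H K := rootSub_le_of_mem (α := α) hx hx0 hxK
      exact Submodule.mem_iSup_of_mem α (Submodule.mem_iSup_of_mem hα hx)

end RootSpaces

/-! ### The grading, read off from integer degrees of roots. -/

section Grading

variable (b : SimpleRoots H) (S : Finset b.support)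

/-- The degree `Z_S(α)` of a root, as an integer. -/
def deg (α : H.root) : ℤ := ∑ i ∈ S, b.coeff α i

variable {b S}

lemma deg_add {α β γ : H.root}
    (h : (rootSystem H).root γ = (rootSystem H).root α + (rootSystem H).root β) :
    deg b S γ = deg b S α + deg b S β := by
  simp [deg, RootPairing.Base.coeff_add h, Finset.sum_add_distrib]

lemma deg_neg {α β : H.root} (h : (rootSystem H).root β = -(rootSystem H).root α) :
    deg b S β = -deg b S α := by
  simp [deg, RootPairing.Base.coeff_neg h]

open scoped Classical in
lemma deg_support (i : b.support) : deg b S i = if i ∈ S then 1 else 0 := by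
  rw [deg, b.coeff_of_support i]
  split_ifs with hi
  · rw [Finset.sum_eq_single_of_mem i hi fun k _ hk => Pi.single_eq_of_ne hk 1, Pi.single_eq_same]
  · exact Finset.sum_eq_zero fun k hk => Pi.single_eq_of_ne (by rintro rfl; exact hi hk) 1

lemma deg_nonneg {α : H.root} (h : b.IsPos α) : 0 ≤ deg b S α :=
  Finset.sum_nonneg fun i _ => h.coeff_nonneg i

lemma isPos_of_deg_pos {α : H.root} (h : 0 < deg b S α) : b.IsPos α := by
  obtain ⟨i, -, hi⟩ := Finset.exists_lt_of_sum_lt (s := S) (f := fun _ => (0 : ℤ))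
    (g := fun i => b.coeff α i) (by simpa [deg] using h)
  exact RootPairing.Base.isPos_of_coeff_pos hi

lemma isPos_negRoot_of_not_isPos {α : H.root} (h : ¬ b.IsPos α) : b.IsPos (negRoot α) := by
  obtain ⟨j, hj⟩ := b.exists_coeff_ne_zero α
  have h1 : b.coeff α j < 0 :=
    lt_of_le_of_ne (le_of_not_gt fun h' => h (RootPairing.Base.isPos_of_coeff_pos h')) hj
  refine RootPairing.Base.isPos_of_coeff_pos (j := j) ?_
  rw [RootPairing.Base.coeff_neg (root_negRoot α)]
  simpa using h1

lemma deg_eq_zero_iff {α : H.root} (h : b.IsPos α) :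
    deg b S α = 0 ↔ ∀ i ∈ S, b.coeff α i = 0 :=
  Finset.sum_eq_zero_iff_of_nonneg fun i _ => h.coeff_nonneg i

lemma root_apply_Z (α : H.root) : α.1 (Z b S) = (deg b S α : ℂ) := by
  classical
  have h (i : b.support) : α.1 (Zi b i) = (b.coeff α i : ℂ) := by
    have h1 := LinearMap.congr_fun (b.root_eq_sum_coeff α) (Zi b i)
    rw [LinearMap.sum_apply, Finset.sum_eq_single i] at h1
    · rw [LinearMap.smul_apply] at h1
      refine h1.trans ?_
      rw [show ((rootSystem H).root (i : H.root)) (Zi b i) = 1 from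
        (simpleRoot_Zi b i i).trans (if_pos rfl)]
      simp
    · intro k _ hk
      rw [LinearMap.smul_apply, show ((rootSystem H).root (k : H.root)) (Zi b i) = 0 from
        (simpleRoot_Zi b i k).trans (if_neg hk), smul_zero]
    · simp
  rw [Z, deg, Int.cast_sum, ← Finset.sum_congr rfl fun i _ => h i]
  exact map_sum (α.1 : Weight ℂ H 𝔤).toLinear _ _

lemma mem_grading {j : ℤ} {x : 𝔤} : x ∈ grading b S j ↔ ⁅(Z b S : 𝔤), x⁆ = (j : ℂ) • x := by
  simp [grading]

lemma mem_grading_of_mem_cartan (h : H) : (h : 𝔤) ∈ grading b S 0 := by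
  rw [mem_grading, Int.cast_zero, zero_smul, ← LieSubalgebra.coe_bracket, trivial_lie_zero]
  rfl

lemma lie_mem_grading {j k : ℤ} {x y : 𝔤} (hx : x ∈ grading b S j) (hy : y ∈ grading b S k) :
    ⁅x, y⁆ ∈ grading b S (j + k) := by
  rw [mem_grading] at *
  rw [leibniz_lie, hx, hy, smul_lie, lie_smul, ← add_smul, Int.cast_add]

lemma cartan_lie_mem_grading {j : ℤ} (h : H) {x : 𝔤} (hx : x ∈ grading b S j) :
    ⁅(h : 𝔤), x⁆ ∈ grading b S j := by
  simpa using lie_mem_grading (mem_grading_of_mem_cartan h) hx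

lemma rootSub_le_grading_iff {α : H.root} {j : ℤ} :
    rootSub α ≤ grading b S j ↔ deg b S α = j := by
  constructor
  · intro h
    obtain ⟨x, hx, hx0⟩ := exists_ne_zero_mem_rootSub α
    have h1 := mem_grading.mp (h hx)
    rw [lie_eq_smul_of_mem_rootSub hx, root_apply_Z] at h1
    exact_mod_cast smul_left_injective ℂ hx0 h1
  · rintro rfl x hx
    rw [mem_grading, lie_eq_smul_of_mem_rootSub hx, root_apply_Z]

/-- A subspace of `𝔤_j`, `j ≠ 0`, stable under the Cartan subalgebra is a sum of root spaces. -/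
lemma eq_iSup_rootSub {K : Submodule ℂ 𝔤} (hK : ∀ h : H, ∀ x ∈ K, ⁅(h : 𝔤), x⁆ ∈ K)
    {j : ℤ} (hj : j ≠ 0) (hKj : K ≤ grading b S j) : K = ⨆ α ∈ rootsOf H K, rootSub α := by
  refine le_antisymm ?_ (iSup₂_le fun α hα => hα)
  refine (le_inf_sup_iSup_rootSub hK).trans (sup_le ?_ le_rfl)
  rintro x ⟨hxK, hxH⟩
  have h1 := mem_grading.mp (hKj hxK)
  rw [mem_grading.mp (mem_grading_of_mem_cartan ⟨x, hxH⟩), Int.cast_zero, zero_smul] at h1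
  have h2 : x = 0 := (smul_eq_zero.mp h1.symm).resolve_left (by exact_mod_cast hj)
  rw [h2]
  exact Submodule.zero_mem _

/-- To check that a linear condition holds on `𝔤_j`, `j ≠ 0`, it suffices to check it on root
vectors. -/
lemma grading_le_of_rootSub {j : ℤ} (hj : j ≠ 0) {K : Submodule ℂ 𝔤}
    (h : ∀ α, deg b S α = j → rootSub α ≤ K) : grading b S j ≤ K := by
  rw [eq_iSup_rootSub (fun h x hx => cartan_lie_mem_grading h hx) hj le_rfl]
  exact iSup₂_le fun α hα => h α (rootSub_le_grading_iff.mp hα)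

/-- To check that a linear condition holds on `𝔤_0`, it suffices to check it on the Cartan
subalgebra and on root vectors. -/
lemma grading_zero_le {K : Submodule ℂ 𝔤} (hH : H.toSubmodule ≤ K)
    (h : ∀ α, deg b S α = 0 → rootSub α ≤ K) : grading b S 0 ≤ K := by
  refine (le_inf_sup_iSup_rootSub fun h x hx => cartan_lie_mem_grading h hx).trans
    (sup_le (inf_le_right.trans hH) (iSup₂_le fun α hα => h α (rootSub_le_grading_iff.mp hα)))

/-- A root of degree `j ≥ 2` is the sum of a root of degree `1` and a root of degree `j - 1`. -/
lemma exists_root_eq_add_of_two_le_deg {α : H.root} (hα : 2 ≤ deg b S α) :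
    ∃ β γ, deg b S β = 1 ∧ deg b S γ = deg b S α - 1 ∧
      (rootSystem H).root α = (rootSystem H).root β + (rootSystem H).root γ := by
  classical
  have hpos : b.IsPos α := isPos_of_deg_pos (S := S) (by lia)
  revert hα
  refine hpos.induction_on_add (p := fun α => 2 ≤ deg b S α → ∃ β γ, deg b S β = 1 ∧
    deg b S γ = deg b S α - 1 ∧
      (rootSystem H).root α = (rootSystem H).root β + (rootSystem H).root γ) ?_ ?_
  · intro i hi h
    have := deg_support (S := S) ⟨i, hi⟩
    simp only at this
    split_ifs at this <;> lia
  · intro α k ε hε ih hk hdeg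
    have hd := deg_add (S := S) hε
    have hdk := deg_support (S := S) ⟨k, hk⟩
    simp only at hdk
    split_ifs at hdk with hkS
    · exact ⟨k, α, hdk, by lia, by rw [hε, add_comm]⟩
    · rw [hdk, add_zero] at hd
      obtain ⟨β, γ, hβ, hγ, hαe⟩ := ih (by lia)
      -- Here α_k has degree 0, so it is not opposite to β or γ and can be absorbed into one of
      -- them.
      have hne {δ : H.root} (hδ : deg b S δ ≠ 0) :
          (rootSystem H).root k + (rootSystem H).root δ ≠ 0 := fun h0 => hδ <| by
        rw [deg_neg (eq_neg_of_add_eq_zero_right h0), hdk, neg_zero]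
      rcases exists_root_eq_add_or_of_add_add (α := k) hαe (by rw [hε, add_comm])
        (hne (by lia)) (hne (by lia)) with ⟨ζ, hζ⟩ | ⟨ζ, hζ⟩
      · have := deg_add (S := S) hζ
        exact ⟨ζ, γ, by lia, by lia, by rw [hε, hαe, hζ]; abel⟩
      · have := deg_add (S := S) hζ
        exact ⟨β, ζ, by lia, by lia, by rw [hε, hαe, hζ]; abel⟩

end Grading

/-! ### The annihilator of the lowest weight vector. -/

section Annihilator

variable {b : SimpleRoots H} {I : Finset b.support} {μ : Dual ℂ H}
  {V : Type*} [AddCommGroup V] [Module ℂ V] [LieRingModule (levi b I) V]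
  [LieModule ℂ (levi b I) V] {φ : V}

lemma annihilator_le_grading : annihilator (levi b I) φ ≤ grading b I 0 :=
  fun _ hx => hx.1

lemma lie_mem_annihilator {x y : 𝔤} (hx : x ∈ annihilator (levi b I) φ)
    (hy : y ∈ annihilator (levi b I) φ) : ⁅x, y⁆ ∈ annihilator (levi b I) φ := by
  obtain ⟨hx, hxφ⟩ := hx
  obtain ⟨hy, hyφ⟩ := hy
  refine ⟨(levi b I).lie_mem hx hy, ?_⟩
  have h : (⟨⁅x, y⁆, (levi b I).lie_mem hx hy⟩ : levi b I) = ⁅(⟨x, hx⟩ : levi b I), ⟨y, hy⟩⁆ := rfl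
  rw [h, lie_lie, hxφ, hyφ, lie_zero, lie_zero, sub_zero]

lemma rootSub_le_levi {α : H.root} (hα : deg b I α = 0) {x : 𝔤} (hx : x ∈ rootSub α) :
    x ∈ levi b I :=
  rootSub_le_grading_iff.mpr hα hx

lemma cartan_mem_levi (h : H) : (h : 𝔤) ∈ levi b I :=
  mem_grading_of_mem_cartan h

lemma deg_nonpos {S : Finset b.support} {α : H.root} (h : ¬ b.IsPos α) : deg b S α ≤ 0 :=
  le_of_not_gt fun h' => h (isPos_of_deg_pos h')

lemma lie_levi_eq_smul {α : H.root} (h : H) {x : 𝔤} (hx : x ∈ rootSub α) (hxl : x ∈ levi b I) :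
    ⁅(⟨h, cartan_mem_levi h⟩ : levi b I), ⟨x, hxl⟩⁆ = α.1 h • (⟨x, hxl⟩ : levi b I) :=
  Subtype.ext (lie_eq_smul_of_mem_rootSub hx h)

/-- Root vectors move eigenvectors of a Cartan element to eigenvectors. -/
lemma lie_mem_eigenspace {α : H.root} {x : 𝔤} (hx : x ∈ rootSub α) (hxl : x ∈ levi b I)
    (h : H) {c : ℂ} {v : V}
    (hv : v ∈ End.eigenspace (toEnd ℂ (levi b I) V ⟨h, cartan_mem_levi h⟩) c) :
    ⁅(⟨x, hxl⟩ : levi b I), v⁆ ∈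
      End.eigenspace (toEnd ℂ (levi b I) V ⟨h, cartan_mem_levi h⟩) (c + α.1 h) := by
  rw [End.mem_eigenspace_iff, toEnd_apply_apply] at *
  rw [leibniz_lie, lie_levi_eq_smul h hx, hv, smul_lie, lie_smul, ← add_smul, add_comm]

/-- The smallest subspace containing `v` and stable under the positive root vectors of `𝔤_0`. -/
def raisingSpan (b : SimpleRoots H) (I : Finset b.support) {V : Type*} [AddCommGroup V]
    [Module ℂ V] [LieRingModule (levi b I) V] [LieModule ℂ (levi b I) V] (v : V) :
    Submodule ℂ V :=
  sInf {U | v ∈ U ∧ ∀ γ : H.root, b.IsPos γ → deg b I γ = 0 → ∀ (x : 𝔤) (_ : x ∈ rootSub γ)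
    (hxl : x ∈ levi b I), ∀ u ∈ U, ⁅(⟨x, hxl⟩ : levi b I), u⁆ ∈ U}

lemma raisingSpan_le {v : V} {U : Submodule ℂ V} (hv : v ∈ U)
    (hU : ∀ γ : H.root, b.IsPos γ → deg b I γ = 0 → ∀ (x : 𝔤) (_ : x ∈ rootSub γ)
      (hxl : x ∈ levi b I), ∀ u ∈ U, ⁅(⟨x, hxl⟩ : levi b I), u⁆ ∈ U) :
    raisingSpan b I v ≤ U :=
  sInf_le ⟨hv, hU⟩

lemma mem_raisingSpan_self (v : V) : v ∈ raisingSpan b I v :=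
  Submodule.mem_sInf.mpr fun _ hU => hU.1

lemma lie_mem_raisingSpan {v : V} {γ : H.root} (hγ : b.IsPos γ) (hdeg : deg b I γ = 0) {x : 𝔤}
    (hx : x ∈ rootSub γ) (hxl : x ∈ levi b I) {w : V} (hw : w ∈ raisingSpan b I v) :
    ⁅(⟨x, hxl⟩ : levi b I), w⁆ ∈ raisingSpan b I v :=
  Submodule.mem_sInf.mpr fun U hU =>
    hU.2 γ hγ hdeg x hx hxl w (Submodule.mem_sInf.mp hw U hU)

/-- If `v` is a weight vector killed by the negative root vectors of `𝔤_0`, then the span of its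
images under positive root vectors is a submodule. -/
lemma levi_lie_mem_raisingSpan {v : V} {lam : H → ℂ}
    (hH : ∀ h : H, ⁅(⟨h, cartan_mem_levi h⟩ : levi b I), v⁆ = lam h • v)
    (hneg : ∀ γ : H.root, ¬ b.IsPos γ → ∀ (x : 𝔤) (_ : x ∈ rootSub γ)
      (hxl : x ∈ levi b I), ⁅(⟨x, hxl⟩ : levi b I), v⁆ = 0)
    (x : levi b I) {w : V} (hw : w ∈ raisingSpan b I v) : ⁅x, w⁆ ∈ raisingSpan b I v := by
  -- Vectors that all of 𝔤_0 sends into the span. By the Leibniz rule this set is stable under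
  -- raising, so only `v` itself has to be checked.
  let K : Submodule ℂ V :=
    { carrier := {w | w ∈ raisingSpan b I v ∧ ∀ x : levi b I, ⁅x, w⁆ ∈ raisingSpan b I v}
      zero_mem' := ⟨Submodule.zero_mem _, fun x => by rw [lie_zero]; exact Submodule.zero_mem _⟩
      add_mem' := fun h h' => ⟨Submodule.add_mem _ h.1 h'.1, fun x => by
        rw [lie_add]; exact Submodule.add_mem _ (h.2 x) (h'.2 x)⟩
      smul_mem' := fun c _ h => ⟨Submodule.smul_mem _ c h.1, fun x => by
        rw [lie_smul]; exact Submodule.smul_mem _ c (h.2 x)⟩ }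
  suffices raisingSpan b I v ≤ K from (this hw).2 x
  refine raisingSpan_le ⟨mem_raisingSpan_self v, fun x => ?_⟩ ?_
  · let K' : Submodule ℂ 𝔤 := ((raisingSpan b I v).comap
      ((toEnd ℂ (levi b I) V : levi b I →ₗ[ℂ] End ℂ V).flip v)).map (levi b I).toSubmodule.subtype
    have hK' : grading b I 0 ≤ K' := by
      refine grading_zero_le (fun h hh => ?_) fun γ hγ x hx => ?_
      · refine ⟨⟨h, cartan_mem_levi ⟨h, hh⟩⟩, ?_, rfl⟩
        change ⁅(⟨h, cartan_mem_levi ⟨h, hh⟩⟩ : levi b I), v⁆ ∈ raisingSpan b I v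
        rw [hH ⟨h, hh⟩]
        exact Submodule.smul_mem _ _ (mem_raisingSpan_self v)
      · refine ⟨⟨x, rootSub_le_levi hγ hx⟩, ?_, rfl⟩
        change ⁅(⟨x, rootSub_le_levi hγ hx⟩ : levi b I), v⁆ ∈ raisingSpan b I v
        by_cases hpos : b.IsPos γ
        · exact lie_mem_raisingSpan hpos hγ hx _ (mem_raisingSpan_self v)
        · rw [hneg γ hpos x hx]
          exact Submodule.zero_mem _
    obtain ⟨y, hy, hyx⟩ := hK' x.2
    rw [← Subtype.ext (a1 := y) (a2 := x) hyx]
    exact hy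
  · intro γ hγ hdeg x hx hxl u hu
    refine ⟨lie_mem_raisingSpan hγ hdeg hx hxl hu.1, fun y => ?_⟩
    rw [leibniz_lie]
    exact Submodule.add_mem _ (hu.2 _) (lie_mem_raisingSpan hγ hdeg hx hxl (hu.2 y))

/-- In an irreducible `𝔤_0`-module, a vector of weight `μ + α_i` killed by the negative root
vectors of `𝔤_0` vanishes as soon as there is a nonzero vector of weight `μ`. -/
lemma eq_zero_of_weight_add_simpleRoot [LieModule.IsIrreducible ℂ (levi b I) V]
    (hφ0 : φ ≠ 0) (hφ : ∀ h : H, ⁅(⟨h, cartan_mem_levi h⟩ : levi b I), φ⁆ = μ h • φ)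
    (i : b.support) {v : V}
    (hH : ∀ h : H, ⁅(⟨h, cartan_mem_levi h⟩ : levi b I), v⁆ = (μ h + (i : H.root).1 h) • v)
    (hneg : ∀ γ : H.root, ¬ b.IsPos γ → ∀ (x : 𝔤) (_ : x ∈ rootSub γ)
      (hxl : x ∈ levi b I), ⁅(⟨x, hxl⟩ : levi b I), v⁆ = 0) : v = 0 := by
  by_contra hv0
  let N : LieSubmodule ℂ (levi b I) V :=
    { raisingSpan b I v with
      lie_mem := fun {x m} hm => levi_lie_mem_raisingSpan hH hneg x hm }
  have hN : N = ⊤ := (eq_bot_or_eq_top N).resolve_left fun h => hv0 <| by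
    have : v ∈ N := mem_raisingSpan_self v
    rwa [h, LieSubmodule.mem_bot] at this
  have hφN : φ ∈ raisingSpan b I v := by
    have : φ ∈ N := hN ▸ LieSubmodule.mem_top φ
    exact this
  -- This element measures height. It acts on `v` by μ(z) + 1, and raising operators add natural
  -- numbers to the eigenvalue, so μ(z), the eigenvalue of φ, is never reached. No finiteness of `V`
  -- is needed.
  let z : H := Z b Finset.univ
  let D : End ℂ V := toEnd ℂ (levi b I) V ⟨z, cartan_mem_levi z⟩
  let U : Submodule ℂ V := ⨆ n : ℕ, D.eigenspace (μ z + 1 + n)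
  have hWU : raisingSpan b I v ≤ U := by
    refine raisingSpan_le ?_ ?_
    · refine Submodule.mem_iSup_of_mem 0 ?_
      rw [End.mem_eigenspace_iff, toEnd_apply_apply, hH z, root_apply_Z, deg_support]
      simp
    · intro γ hγ hdeg x hx hxl
      change U ≤ U.comap (toEnd ℂ (levi b I) V ⟨x, hxl⟩)
      refine iSup_le fun n u hu => ?_
      obtain ⟨d, hd⟩ := Int.eq_ofNat_of_zero_le (deg_nonneg (S := Finset.univ) hγ)
      refine Submodule.mem_iSup_of_mem (n + d) ?_
      have := lie_mem_eigenspace hx hxl z hu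
      rw [root_apply_Z, hd, add_assoc] at this
      rw [Nat.cast_add]
      exact this
  have hdisj := D.eigenspaces_iSupIndep (μ z)
  refine hφ0 (Submodule.disjoint_def.mp hdisj φ ?_ ?_)
  · rw [End.mem_eigenspace_iff, toEnd_apply_apply, hφ z]
  · refine (iSup_le fun n => ?_ : U ≤ _) (hWU hφN)
    refine le_iSup₂_of_le (μ z + 1 + n) (fun h => ?_) le_rfl
    rw [add_assoc, add_eq_left] at h
    exact Nat.cast_add_one_ne_zero n ((add_comm _ _).trans h)

namespace IsLowestWeightVector

variable (hφ : IsLowestWeightVector b I μ φ)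
include hφ

lemma cartan_mem_annihilator_iff (h : H) :
    (h : 𝔤) ∈ annihilator (levi b I) φ ↔ μ h = 0 := by
  constructor
  · rintro ⟨hh, h0⟩
    rw [hφ.weight h hh] at h0
    exact (smul_eq_zero.mp h0).resolve_right hφ.ne_zero
  · intro h0
    exact ⟨cartan_mem_levi h, by rw [hφ.weight h, h0, zero_smul]⟩

lemma cartan_lie_mem_annihilator (h : H) {x : 𝔤} (hx : x ∈ annihilator (levi b I) φ) :
    ⁅(h : 𝔤), x⁆ ∈ annihilator (levi b I) φ := by
  obtain ⟨hx, hxφ⟩ := hx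
  have hh : (h : 𝔤) ∈ levi b I := cartan_mem_levi h
  refine ⟨(levi b I).lie_mem hh hx, ?_⟩
  have h1 : (⟨⁅(h : 𝔤), x⁆, (levi b I).lie_mem hh hx⟩ : levi b I) =
    ⁅(⟨h, hh⟩ : levi b I), ⟨x, hx⟩⁆ := rfl
  rw [h1, lie_lie, hxφ, hφ.weight h hh, lie_smul, hxφ, lie_zero, smul_zero, sub_zero]

lemma lie_eq_zero_of_not_isPos {α : H.root} (hα : ¬ b.IsPos α) {x : 𝔤} (hx : x ∈ rootSub α)
    (hxl : x ∈ levi b I) : ⁅(⟨x, hxl⟩ : levi b I), φ⁆ = 0 :=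
  hφ.lowest (negRoot α) (isPos_negRoot_of_not_isPos hα) x hxl <| by
    rw [← rootSub_negRoot]
    have : negRoot (negRoot α) = α := (rootSystem H).root.injective <| by
      rw [root_negRoot, root_negRoot, neg_neg]
    rwa [this]

lemma rootSub_le_annihilator_of_not_isPos {α : H.root} (hα : ¬ b.IsPos α)
    (hdeg : deg b I α = 0) : rootSub α ≤ annihilator (levi b I) φ :=
  fun _ hx => ⟨rootSub_le_levi hdeg hx, hφ.lie_eq_zero_of_not_isPos hα hx _⟩

/-- The vector e φ has weight μ + α_i. A negative root vector x kills it because [x, e] is zero, a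
multiple of α_i^∨ (on which μ vanishes), or a negative root vector of 𝔤_0. -/
lemma simpleRootSub_le_annihilator [LieModule.IsIrreducible ℂ (levi b I) V] {i : b.support}
    (hi : i ∉ I) (hμi : weightCoeff b μ i = 0) :
    rootSub (i : H.root) ≤ annihilator (levi b I) φ := by
  intro e he
  have hdeg : deg b I (i : H.root) = 0 := by classical rw [deg_support, if_neg hi]
  have hel := rootSub_le_levi hdeg he
  refine ⟨hel, eq_zero_of_weight_add_simpleRoot hφ.ne_zero (fun h => hφ.weight h _) i ?_ ?_⟩
  · intro h
    rw [leibniz_lie, lie_levi_eq_smul h he, hφ.weight h, smul_lie, lie_smul, ← add_smul, add_comm]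
  · intro γ hγ x hx hxl
    rw [leibniz_lie, hφ.lie_eq_zero_of_not_isPos hγ hx hxl, lie_zero, add_zero]
    suffices ⁅x, e⁆ ∈ annihilator (levi b I) φ from this.2
    by_cases h0 : (rootSystem H).root γ + (rootSystem H).root i = 0
    · obtain ⟨c, hc⟩ := exists_lie_eq_smul_coroot (eq_neg_of_add_eq_zero_left h0) he hx
      rw [← lie_skew, hc]
      exact neg_mem (Submodule.smul_mem _ _ ((hφ.cartan_mem_annihilator_iff _).mpr hμi))
    by_cases h1 : ∃ δ, (rootSystem H).root δ = (rootSystem H).root γ + (rootSystem H).root i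
    · obtain ⟨δ, hδ⟩ := h1
      -- Were γ + α_i positive with γ negative, both would be supported at i alone, where adding 1
      -- to a negative integer cannot give a positive one.
      have hδpos : ¬ b.IsPos δ := by
        classical
        intro hpos
        have hγ' (j) : b.coeff γ j ≤ 0 :=
          le_of_not_gt fun h' => hγ (RootPairing.Base.isPos_of_coeff_pos h')
        have hadd (j) : b.coeff δ j = b.coeff γ j + (Pi.single i 1 : b.support → ℤ) j := by
          rw [RootPairing.Base.coeff_add hδ, b.coeff_of_support i]; rfl
        have hne (j) (hj : j ≠ i) : b.coeff γ j = 0 ∧ b.coeff δ j = 0 := by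
          have h1 := hadd j
          have h2 := hγ' j
          have h3 := hpos.coeff_nonneg j
          rw [Pi.single_eq_of_ne hj] at h1
          lia
        obtain ⟨j, hj⟩ := b.exists_coeff_ne_zero δ
        obtain ⟨k, hk⟩ := b.exists_coeff_ne_zero γ
        obtain rfl : j = i := by by_contra h; exact hj (hne j h).2
        obtain rfl : k = j := by by_contra h; exact hk (hne k h).1
        have h1 := hadd k
        have h2 := hγ' k
        have h3 := hpos.coeff_nonneg k
        rw [Pi.single_eq_same] at h1
        lia
      -- Only `x ∈ levi b I` is given; this fixes the degree of γ once x ≠ 0.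
      have hxdeg : deg b I γ = 0 ∨ x = 0 := by
        rcases eq_or_ne x 0 with h | h
        · exact Or.inr h
        · exact Or.inl (rootSub_le_grading_iff.mp (rootSub_le_of_mem hx h hxl))
      rcases hxdeg with h | rfl
      · exact hφ.rootSub_le_annihilator_of_not_isPos hδpos
          (by rw [deg_add hδ, h, hdeg, add_zero]) (lie_mem_rootSub hδ hx he)
      · rw [zero_lie]; exact Submodule.zero_mem _
    · push Not at h1
      rw [lie_eq_zero_of_add_ne h0 h1 hx he]
      exact Submodule.zero_mem _

/-- Such a root is built up through positive roots by adding simple roots outside I and J_μ, whose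
root vectors kill φ, and the annihilator is closed under brackets. -/
lemma rootSub_le_annihilator [LieModule.IsIrreducible ℂ (levi b I) V] {α : H.root}
    (hα : b.IsPos α) (hI : deg b I α = 0) (hJ : deg b (Jmu b I μ) α = 0) :
    rootSub α ≤ annihilator (levi b I) φ := by
  classical
  suffices b.IsPos α ∧ (deg b I α = 0 → deg b (Jmu b I μ) α = 0 →
    rootSub α ≤ annihilator (levi b I) φ) from this.2 hI hJ
  have hsimple (i) (hi : i ∈ b.support) (hI : deg b I i = 0) (hJ : deg b (Jmu b I μ) i = 0) :
      rootSub i ≤ annihilator (levi b I) φ := by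
    have h1 := deg_support (S := I) ⟨i, hi⟩
    have h2 := deg_support (S := Jmu b I μ) ⟨i, hi⟩
    have hiI : ⟨i, hi⟩ ∉ I := fun h => by rw [if_pos h] at h1; lia
    have hiJ : ⟨i, hi⟩ ∉ Jmu b I μ := fun h => by rw [if_pos h] at h2; lia
    exact hφ.simpleRootSub_le_annihilator (i := ⟨i, hi⟩) hiI (by simpa [Jmu, hiI] using hiJ)
  refine hα.induction_on_add (p := fun α => b.IsPos α ∧ (deg b I α = 0 →
    deg b (Jmu b I μ) α = 0 → rootSub α ≤ annihilator (levi b I) φ)) ?_ ?_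
  · exact fun i hi => ⟨RootPairing.Base.isPos_of_mem_support hi, hsimple i hi⟩
  · intro α k γ hγ ⟨hα, ih⟩ hk
    have hkpos := RootPairing.Base.isPos_of_mem_support hk
    refine ⟨hα.add hkpos hγ, fun h1 h2 => ?_⟩
    rw [deg_add hγ] at h1 h2
    have h3 := deg_nonneg (S := I) hα
    have h4 := deg_nonneg (S := I) hkpos
    have h5 := deg_nonneg (S := Jmu b I μ) hα
    have h6 := deg_nonneg (S := Jmu b I μ) hkpos
    exact rootSub_le_of_lie_mem hγ fun x hx y hy => lie_mem_annihilator
      (ih (by lia) (by lia) hx) (hsimple k hk (by lia) (by lia) hy)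

end IsLowestWeightVector

end Annihilator

/-! ### Splitting roots of the prolongation. -/

section Prolongation

variable {b : SimpleRoots H} {I : Finset b.support} {a0 : Submodule ℂ 𝔤}

lemma prolongationNonneg_le_grading (h0 : a0 ≤ grading b I 0) :
    ∀ n : ℕ, prolongationNonneg (grading b I) a0 n ≤ grading b I n
  | 0 => h0
  | n + 1 => fun x hx => by
    have := hx.1
    rwa [← Nat.cast_succ] at this

lemma lie_mem_prolongationNonneg_of_mem_grading_neg_one {n : ℕ} {x y : 𝔤}
    (hx : x ∈ grading b I (-1)) (hy : y ∈ prolongationNonneg (grading b I) a0 (n + 1)) :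
    ⁅x, y⁆ ∈ prolongationNonneg (grading b I) a0 n := by
  rw [← lie_skew]
  exact neg_mem (hy.2 x hx)

lemma cartan_lie_mem_prolongationNonneg (h0 : ∀ h : H, ∀ x ∈ a0, ⁅(h : 𝔤), x⁆ ∈ a0) (h : H) :
    ∀ n : ℕ, ∀ x ∈ prolongationNonneg (grading b I) a0 n,
      ⁅(h : 𝔤), x⁆ ∈ prolongationNonneg (grading b I) a0 n
  | 0 => h0 h
  | n + 1 => fun x hx => by
    refine ⟨cartan_lie_mem_grading h hx.1, fun y hy => ?_⟩
    rw [lie_lie]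
    exact sub_mem (cartan_lie_mem_prolongationNonneg h0 h n _ (hx.2 y hy))
      (hx.2 _ (cartan_lie_mem_grading h hy))

/-- Bracketing with a root vector of degree `-(k + 1)` lowers the degree in the prolongation. -/
lemma lie_mem_prolongationNonneg_of_deg {k : ℕ} {γ : H.root} (hγ : deg b I γ = k + 1) (j : ℕ)
    {x z : 𝔤} (hx : x ∈ rootSub (negRoot γ))
    (hz : z ∈ prolongationNonneg (grading b I) a0 (j + k + 1)) :
    ⁅x, z⁆ ∈ prolongationNonneg (grading b I) a0 j := by
  induction k generalizing γ j x z with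
  | zero =>
    refine lie_mem_prolongationNonneg_of_mem_grading_neg_one
      (rootSub_le_grading_iff.mpr ?_ hx) hz
    rw [deg_neg (root_negRoot γ), hγ]
    simp
  | succ k ih =>
    obtain ⟨γ₁, γ₂, h1, h2, h⟩ := exists_root_eq_add_of_two_le_deg (b := b) (S := I) (α := γ)
      (by rw [hγ]; push_cast; lia)
    have hneg : (rootSystem H).root (negRoot γ) =
        (rootSystem H).root (negRoot γ₁) + (rootSystem H).root (negRoot γ₂) := by
      simp only [root_negRoot, h, neg_add]
    let K : Submodule ℂ 𝔤 :=
      { carrier := {x | ∀ z ∈ prolongationNonneg (grading b I) a0 (j + (k + 1) + 1),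
          ⁅x, z⁆ ∈ prolongationNonneg (grading b I) a0 j}
        zero_mem' := fun z _ => by rw [zero_lie]; exact Submodule.zero_mem _
        add_mem' := fun h h' z hz => by rw [add_lie]; exact add_mem (h z hz) (h' z hz)
        smul_mem' := fun c _ h z hz => by rw [smul_lie]; exact Submodule.smul_mem _ c (h z hz) }
    refine (rootSub_le_of_lie_mem hneg (K := K) fun y₁ hy₁ y₂ hy₂ z hz => ?_) hx z hz
    have hy₁' : y₁ ∈ grading b I (-1) :=
      rootSub_le_grading_iff.mpr (by rw [deg_neg (root_negRoot γ₁), h1]) hy₁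
    have hγ₂ : deg b I γ₂ = k + 1 := by rw [h2, hγ]; push_cast; ring
    rw [lie_lie]
    refine sub_mem (lie_mem_prolongationNonneg_of_mem_grading_neg_one hy₁'
      (ih hγ₂ (j + 1) hy₂ ?_)) (ih hγ₂ j hy₂
        (lie_mem_prolongationNonneg_of_mem_grading_neg_one hy₁' hz))
    rwa [show j + 1 + k + 1 = j + (k + 1) + 1 by ring]

/-- A root of the prolongation in degree `n + 2` is the sum of roots of the prolongation in degrees
`1` and `n + 1`. -/
lemma exists_root_eq_add_of_rootSub_le (h0 : a0 ≤ grading b I 0) {n : ℕ} {α : H.root}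
    (hα : rootSub α ≤ prolongationNonneg (grading b I) a0 (n + 2)) :
    ∃ β γ, rootSub β ≤ prolongationNonneg (grading b I) a0 1 ∧
      rootSub γ ≤ prolongationNonneg (grading b I) a0 (n + 1) ∧
      (rootSystem H).root α = (rootSystem H).root β + (rootSystem H).root γ := by
  have hdeg := rootSub_le_grading_iff.mp (hα.trans (prolongationNonneg_le_grading h0 _))
  obtain ⟨β, γ, h1, h2, h⟩ := exists_root_eq_add_of_two_le_deg (b := b) (S := I) (α := α)
    (by rw [hdeg]; push_cast; lia)
  have hγ : deg b I γ = n + 1 := by rw [h2, hdeg]; push_cast; ring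
  refine ⟨β, γ, ?_, ?_, h⟩
  -- Recover β = α - γ and then γ = α - β by bracketing 𝔤_α with 𝔤_{-γ} and with 𝔤_{-β}.
  · refine rootSub_le_of_lie_mem (α := negRoot γ) (β := α) (by rw [root_negRoot, h]; abel)
      fun y hy z hz => lie_mem_prolongationNonneg_of_deg hγ 1 hy ?_
    rw [show 1 + n + 1 = n + 2 by ring]
    exact hα hz
  · refine rootSub_le_of_lie_mem (α := negRoot β) (β := α) (by rw [root_negRoot, h]; abel)
      fun y hy z hz => lie_mem_prolongationNonneg_of_mem_grading_neg_one ?_ (hα hz)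
    exact rootSub_le_grading_iff.mpr (by rw [deg_neg (root_negRoot β), h1]) hy

end Prolongation

/-! ### The roots of 𝔞_j for j ≥ 1. -/

section Roots

variable {b : SimpleRoots H} {I : Finset b.support} {μ : Dual ℂ H}
  {V : Type*} [AddCommGroup V] [Module ℂ V] [LieRingModule (levi b I) V]
  [LieModule ℂ (levi b I) V] {φ : V}

lemma mem_Imu {i : b.support} : i ∈ Imu b I μ ↔ i ∈ I ∧ weightCoeff b μ i = 0 := by
  simp [Imu]

lemma mem_Jmu {i : b.support} : i ∈ Jmu b I μ ↔ i ∉ I ∧ weightCoeff b μ i ≠ 0 := by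
  simp [Jmu]

lemma Imu_subset : Imu b I μ ⊆ I := fun _ hi => (mem_Imu.mp hi).1

lemma deg_le_deg_of_subset {S T : Finset b.support} (hST : S ⊆ T) {α : H.root}
    (hα : b.IsPos α) : deg b S α ≤ deg b T α :=
  Finset.sum_le_sum_of_subset_of_nonneg hST fun i _ _ => hα.coeff_nonneg i

lemma deg_le_deg_of_subset_of_not_isPos {S T : Finset b.support} (hST : S ⊆ T) {α : H.root}
    (hα : ¬ b.IsPos α) : deg b T α ≤ deg b S α := by
  have := deg_le_deg_of_subset hST (isPos_negRoot_of_not_isPos hα)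
  rw [deg_neg (root_negRoot α), deg_neg (root_negRoot α)] at this
  lia

lemma coeff_eq_zero_of_deg_eq {S T : Finset b.support} (hST : S ⊆ T) {α : H.root}
    (hα : b.IsPos α) (h : deg b S α = deg b T α) {i : b.support} (hiT : i ∈ T) (hiS : i ∉ S) :
    b.coeff α i = 0 := by
  classical
  have h1 : deg b (T \ S) α = 0 := by
    have := Finset.sum_sdiff (f := fun i => b.coeff α i) hST
    unfold deg at *
    lia
  exact (deg_eq_zero_iff hα).mp h1 i (Finset.mem_sdiff.mpr ⟨hiT, hiS⟩)

/-- The roots of degree `j` supported away from `I \ I_μ` and `J_μ`. -/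
def IsReducedRoot (b : SimpleRoots H) (I : Finset b.support) (μ : Dual ℂ H) (j : ℤ)
    (α : H.root) : Prop :=
  deg b I α = j ∧ deg b (Imu b I μ) α = j ∧ deg b (Jmu b I μ) α = 0

lemma IsReducedRoot.add {j k : ℤ} {α β γ : H.root} (hα : IsReducedRoot b I μ j α)
    (hβ : IsReducedRoot b I μ k β)
    (h : (rootSystem H).root γ = (rootSystem H).root α + (rootSystem H).root β) :
    IsReducedRoot b I μ (j + k) γ :=
  ⟨by rw [deg_add h, hα.1, hβ.1], by rw [deg_add h, hα.2.1, hβ.2.1],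
    by rw [deg_add h, hα.2.2, hβ.2.2, add_zero]⟩

lemma apply_coroot_eq_sum (α : H.root) :
    μ ((rootSystem H).coroot α) = ∑ i, (b.flip.coeff α i : ℂ) * weightCoeff b μ i := by
  rw [b.coroot_eq_sum_coeff_flip α, map_sum]
  exact Finset.sum_congr rfl fun i _ => by rw [map_zsmul, zsmul_eq_mul]; rfl

/-- The coroot has the same support as α, and μ vanishes on every simple coroot in that support. -/
lemma IsReducedRoot.apply_coroot_eq_zero {j : ℤ} {α : H.root} (hα : IsReducedRoot b I μ j α)
    (hpos : b.IsPos α) : μ ((rootSystem H).coroot α) = 0 := by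
  rw [apply_coroot_eq_sum]
  refine Finset.sum_eq_zero fun i _ => ?_
  by_cases hμ : weightCoeff b μ i = 0
  · rw [hμ, mul_zero]
  · suffices b.coeff α i = 0 by
      rw [RootPairing.Base.coeff_flip_eq_zero_iff.mpr this, Int.cast_zero, zero_mul]
    by_cases hi : i ∈ I
    · exact coeff_eq_zero_of_deg_eq Imu_subset hpos (hα.2.1.trans hα.1.symm) hi
        fun h => hμ (mem_Imu.mp h).2
    · exact (deg_eq_zero_iff hpos).mp hα.2.2 i (mem_Jmu.mpr ⟨hi, hμ⟩)

/-- Stability of 𝔞_1 under 𝔞_0, which allows roots of 𝔞_1 to be lowered by negative roots of 𝔤_0. -/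
lemma lie_mem_prolongationNonneg_one {x z : 𝔤} (hx : x ∈ annihilator (levi b I) φ)
    (hz : z ∈ prolongationNonneg (grading b I) (annihilator (levi b I) φ) 1) :
    ⁅x, z⁆ ∈ prolongationNonneg (grading b I) (annihilator (levi b I) φ) 1 := by
  refine ⟨by simpa using lie_mem_grading (annihilator_le_grading hx) hz.1, fun y hy => ?_⟩
  rw [lie_lie]
  refine sub_mem (lie_mem_annihilator hx (hz.2 y hy)) (hz.2 _ ?_)
  simpa using lie_mem_grading (annihilator_le_grading hx) hy

namespace IsLowestWeightVector

variable (hφ : IsLowestWeightVector b I μ φ)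
include hφ

lemma rootSub_le_prolongationNonneg [LieModule.IsIrreducible ℂ (levi b I) V] {n : ℕ}
    {α : H.root} (hα : IsReducedRoot b I μ (n + 1) α) :
    rootSub α ≤ prolongationNonneg (grading b I) (annihilator (levi b I) φ) (n + 1) := by
  induction n generalizing α with
  | zero =>
    intro x hx
    have hαpos : b.IsPos α := isPos_of_deg_pos (S := I) (by rw [hα.1]; simp)
    refine ⟨rootSub_le_grading_iff.mpr hα.1 hx, ?_⟩
    change grading b I (-1) ≤ (annihilator (levi b I) φ).comap (ad ℂ 𝔤 x : 𝔤 →ₗ[ℂ] 𝔤)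
    refine grading_le_of_rootSub (by simp) fun β hβ y hy => ?_
    change ⁅x, y⁆ ∈ annihilator (levi b I) φ
    by_cases h0 : (rootSystem H).root α + (rootSystem H).root β = 0
    · obtain ⟨c, hc⟩ := exists_lie_eq_smul_coroot (eq_neg_of_add_eq_zero_right h0) hx hy
      rw [hc]
      exact Submodule.smul_mem _ _
        ((hφ.cartan_mem_annihilator_iff _).mpr (hα.apply_coroot_eq_zero hαpos))
    by_cases h1 : ∃ δ, (rootSystem H).root δ = (rootSystem H).root α + (rootSystem H).root β
    · obtain ⟨δ, hδ⟩ := h1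
      have hβneg : ¬ b.IsPos β := fun h => by
        have := deg_nonneg (S := I) h
        lia
      have hδI : deg b I δ = 0 := by rw [deg_add hδ, hα.1, hβ]; simp
      refine (?_ : rootSub δ ≤ _) (lie_mem_rootSub hδ hx hy)
      by_cases hδpos : b.IsPos δ
      · refine hφ.rootSub_le_annihilator hδpos hδI ?_
        have h1 := deg_nonneg (S := Jmu b I μ) hδpos
        have h2 := deg_nonpos (S := Jmu b I μ) hβneg
        rw [deg_add hδ, hα.2.2] at h1 ⊢
        lia
      · exact hφ.rootSub_le_annihilator_of_not_isPos hδpos hδI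
    · push Not at h1
      rw [lie_eq_zero_of_add_ne h0 h1 hx hy]
      exact Submodule.zero_mem _
  | succ n ih =>
    intro x hx
    refine ⟨rootSub_le_grading_iff.mpr hα.1 hx, ?_⟩
    change grading b I (-1) ≤ (prolongationNonneg (grading b I) (annihilator (levi b I) φ)
      (n + 1)).comap (ad ℂ 𝔤 x : 𝔤 →ₗ[ℂ] 𝔤)
    refine grading_le_of_rootSub (by simp) fun β hβ y hy => ?_
    change ⁅x, y⁆ ∈ prolongationNonneg (grading b I) (annihilator (levi b I) φ) (n + 1)
    have h0 : (rootSystem H).root α + (rootSystem H).root β ≠ 0 := fun h0 => by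
      have h1 := deg_neg (b := b) (S := I) (eq_neg_of_add_eq_zero_right h0)
      have h2 := hα.1
      push_cast at h2
      lia
    by_cases h1 : ∃ δ, (rootSystem H).root δ = (rootSystem H).root α + (rootSystem H).root β
    · obtain ⟨δ, hδ⟩ := h1
      have hβneg : ¬ b.IsPos β := fun h => by
        have := deg_nonneg (S := I) h
        lia
      have hδI : deg b I δ = n + 1 := by rw [deg_add hδ, hα.1, hβ]; push_cast; ring
      have hδpos : b.IsPos δ := isPos_of_deg_pos (S := I) (by lia)
      have h1 := deg_add (S := Imu b I μ) hδ
      have h2 := deg_add (S := Jmu b I μ) hδ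
      -- The I_μ-degree of β is at least -1, so that of δ is at least n + 1; it is also at most the
      -- I-degree of δ, which is n + 1.
      have h3 := deg_le_deg_of_subset_of_not_isPos (Imu_subset (I := I) (μ := μ)) hβneg
      have h4 := deg_le_deg_of_subset (Imu_subset (I := I) (μ := μ)) hδpos
      have h5 := deg_nonneg (S := Jmu b I μ) hδpos
      have h6 := deg_nonpos (S := Jmu b I μ) hβneg
      have h7 := hα.2.1
      have h8 := hα.2.2
      push_cast at h7
      exact ih ⟨hδI, by lia, by lia⟩ (lie_mem_rootSub hδ hx hy)
    · push Not at h1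
      rw [lie_eq_zero_of_add_ne h0 h1 hx hy]
      exact Submodule.zero_mem _

lemma apply_coroot_eq_zero_of_rootSub_le {α : H.root}
    (hα : rootSub α ≤ prolongationNonneg (grading b I) (annihilator (levi b I) φ) 1) :
    μ ((rootSystem H).coroot α) = 0 := by
  obtain ⟨x, hx, y, hy, hxy⟩ := exists_lie_eq_coroot α
  have hdeg := rootSub_le_grading_iff.mp
    (hα.trans (prolongationNonneg_le_grading annihilator_le_grading _))
  have := (hα hx).2 y (rootSub_le_grading_iff.mpr
    (by rw [deg_neg (root_negRoot α), hdeg, Nat.cast_one]) hy)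
  rw [hxy] at this
  exact (hφ.cartan_mem_annihilator_iff _).mp this

/-- A root of degree 1 involves exactly one simple root of I, with coefficient 1. Stripping off
roots of degree 0 shows that this simple root itself lies in 𝔞_1, so μ vanishes on its coroot. -/
lemma deg_Imu_eq_one {α : H.root}
    (hα : rootSub α ≤ prolongationNonneg (grading b I) (annihilator (levi b I) φ) 1) :
    deg b (Imu b I μ) α = 1 := by
  classical
  have hdeg {α : H.root}
      (hα : rootSub α ≤ prolongationNonneg (grading b I) (annihilator (levi b I) φ) 1) :
      deg b I α = 1 := by
    simpa using rootSub_le_grading_iff.mp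
      (hα.trans (prolongationNonneg_le_grading annihilator_le_grading _))
  have hsimple (i) (hi : i ∈ b.support)
      (h : rootSub i ≤ prolongationNonneg (grading b I) (annihilator (levi b I) φ) 1) :
      deg b (Imu b I μ) i = 1 := by
    have h1 := deg_support (S := I) ⟨i, hi⟩
    rw [hdeg h] at h1
    have hiI : ⟨i, hi⟩ ∈ I := by
      by_contra h2
      rw [if_neg h2] at h1
      lia
    exact (deg_support ⟨i, hi⟩).trans
      (if_pos (mem_Imu.mpr ⟨hiI, hφ.apply_coroot_eq_zero_of_rootSub_le h⟩))
  have hpos : b.IsPos α := isPos_of_deg_pos (S := I) (by rw [hdeg hα]; simp)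
  suffices b.IsPos α ∧
      (rootSub α ≤ prolongationNonneg (grading b I) (annihilator (levi b I) φ) 1 →
        deg b (Imu b I μ) α = 1) from this.2 hα
  refine hpos.induction_on_add (p := fun α => b.IsPos α ∧
    (rootSub α ≤ prolongationNonneg (grading b I) (annihilator (levi b I) φ) 1 →
      deg b (Imu b I μ) α = 1)) ?_ ?_
  · exact fun i hi => ⟨RootPairing.Base.isPos_of_mem_support hi, hsimple i hi⟩
  · intro α k γ hγ ⟨hα, ih⟩ hk
    have hkpos := RootPairing.Base.isPos_of_mem_support hk
    refine ⟨hα.add hkpos hγ, fun hγ1 => ?_⟩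
    have hlower {δ ε : H.root} (hδ : b.IsPos δ) (hδI : deg b I δ = 0)
        (hε : (rootSystem H).root γ = (rootSystem H).root ε + (rootSystem H).root δ) :
        rootSub ε ≤ prolongationNonneg (grading b I) (annihilator (levi b I) φ) 1 := by
      refine rootSub_le_of_lie_mem (α := negRoot δ) (β := γ) (by rw [root_negRoot, hε]; abel)
        fun y hy z hz => lie_mem_prolongationNonneg_one
          (hφ.rootSub_le_annihilator_of_not_isPos ?_ ?_ hy) (hγ1 hz)
      · exact fun h => by
          obtain ⟨j, hj⟩ := b.exists_coeff_ne_zero δ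
          have h1 := h.coeff_nonneg j
          have h2 := hδ.coeff_nonneg j
          rw [RootPairing.Base.coeff_neg (root_negRoot δ), Pi.neg_apply] at h1
          lia
      · rw [deg_neg (root_negRoot δ), hδI, neg_zero]
    have hsum := deg_add (S := I) hγ
    have hsum' := deg_add (S := Imu b I μ) hγ
    have h1 := deg_support (S := I) ⟨k, hk⟩
    have h3 := deg_le_deg_of_subset (Imu_subset (I := I) (μ := μ)) hkpos
    have h4 := deg_nonneg (S := Imu b I μ) hkpos
    have h5 := deg_le_deg_of_subset (Imu_subset (I := I) (μ := μ)) hα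
    have h6 := deg_nonneg (S := Imu b I μ) hα
    have h7 := hdeg hγ1
    simp only at h1
    split_ifs at h1 with hkI
    -- If α_k ∈ I, the rest α has degree 0 and subtracting it leaves α_k; in the other case α_k is
    -- subtracted and induction applies to α.
    · have hk1 := hsimple k hk (hlower hα (by lia) (by rw [hγ, add_comm]))
      lia
    · have := ih (hlower hkpos h1 hγ)
      lia

/-- Expand μ(α^∨) = 0 over simple coroots: terms in I vanish, the others have nonpositive real part
by dominance of -μ, so each real part is zero. -/
lemma isReducedRoot_of_rootSub_le_one (hμ : IsDominant b I (-μ)) {α : H.root}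
    (hα : rootSub α ≤ prolongationNonneg (grading b I) (annihilator (levi b I) φ) 1) :
    IsReducedRoot b I μ 1 α := by
  have hI : deg b I α = 1 := by
    simpa using rootSub_le_grading_iff.mp
      (hα.trans (prolongationNonneg_le_grading annihilator_le_grading _))
  have hImu := hφ.deg_Imu_eq_one hα
  have hpos : b.IsPos α := isPos_of_deg_pos (S := I) (by lia)
  refine ⟨hI, hImu, (deg_eq_zero_iff hpos).mpr fun i hi => ?_⟩
  have hre (k : b.support) (hk : k ∉ I) : (weightCoeff b μ k).re ≤ 0 := by
    have := (hμ k hk).1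
    rwa [show weightCoeff b (-μ) k = -weightCoeff b μ k from rfl, Complex.neg_re,
      neg_nonneg] at this
  have h0 := congrArg Complex.re (hφ.apply_coroot_eq_zero_of_rootSub_le hα)
  rw [apply_coroot_eq_sum (b := b), Complex.re_sum, Complex.zero_re] at h0
  have hterm (k : b.support) : ((b.flip.coeff α k : ℂ) * weightCoeff b μ k).re =
      b.flip.coeff α k * (weightCoeff b μ k).re := by
    simp
  have hle (k : b.support) : ((b.flip.coeff α k : ℂ) * weightCoeff b μ k).re ≤ 0 := by
    rw [hterm]
    by_cases hkI : k ∈ I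
    · by_cases hk : k ∈ Imu b I μ
      · rw [(mem_Imu.mp hk).2]; simp
      · rw [RootPairing.Base.coeff_flip_eq_zero_iff.mpr
          (coeff_eq_zero_of_deg_eq Imu_subset hpos (hImu.trans hI.symm) hkI hk)]; simp
    · exact mul_nonpos_of_nonneg_of_nonpos (by exact_mod_cast hpos.coeff_flip_nonneg k) (hre k hkI)
  have hi0 := (Finset.sum_eq_zero_iff_of_nonpos fun k _ => hle k).mp h0 i (Finset.mem_univ i)
  rw [hterm] at hi0
  obtain ⟨hiI, hiμ⟩ := mem_Jmu.mp hi
  refine RootPairing.Base.coeff_flip_eq_zero_iff.mp ?_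
  rcases mul_eq_zero.mp hi0 with h | h
  · exact_mod_cast h
  -- Dominance also makes the value real, so a zero real part would contradict i ∈ J_μ.
  · have him := (hμ i hiI).2
    rw [show weightCoeff b (-μ) i = -weightCoeff b μ i from rfl, Complex.neg_im,
      neg_eq_zero] at him
    exact absurd (Complex.ext h him) hiμ

lemma isReducedRoot_of_rootSub_le (hμ : IsDominant b I (-μ)) {n : ℕ} {α : H.root}
    (hα : rootSub α ≤ prolongationNonneg (grading b I) (annihilator (levi b I) φ) (n + 1)) :
    IsReducedRoot b I μ (n + 1) α := by
  induction n generalizing α with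
  | zero => simpa using hφ.isReducedRoot_of_rootSub_le_one hμ hα
  | succ n ih =>
    obtain ⟨β, γ, hβ, hγ, h⟩ := exists_root_eq_add_of_rootSub_le annihilator_le_grading hα
    have := (hφ.isReducedRoot_of_rootSub_le_one hμ hβ).add (ih hγ) h
    rwa [add_comm, ← Nat.cast_succ] at this

lemma rootSub_le_prolongationNonneg_iff [LieModule.IsIrreducible ℂ (levi b I) V]
    (hμ : IsDominant b I (-μ)) {n : ℕ} {α : H.root} :
    rootSub α ≤ prolongationNonneg (grading b I) (annihilator (levi b I) φ) (n + 1) ↔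
      IsReducedRoot b I μ (n + 1) α :=
  ⟨hφ.isReducedRoot_of_rootSub_le hμ, hφ.rootSub_le_prolongationNonneg⟩

end IsLowestWeightVector

end Roots

/-! ### Generation by 𝔞_1. -/

section Generation

variable {b : SimpleRoots H} {I : Finset b.support} {μ : Dual ℂ H}
  {V : Type*} [AddCommGroup V] [Module ℂ V] [LieRingModule (levi b I) V]
  [LieModule ℂ (levi b I) V] {φ : V}

lemma tanaka_one : tanaka b I φ 1 =
    prolongationNonneg (grading b I) (annihilator (levi b I) φ) 1 := rfl

namespace IsLowestWeightVector

variable (hφ : IsLowestWeightVector b I μ φ)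
include hφ

lemma prolongationNonneg_eq_iSup (n : ℕ) :
    prolongationNonneg (grading b I) (annihilator (levi b I) φ) (n + 1) =
      ⨆ α ∈ rootsOf H (prolongationNonneg (grading b I) (annihilator (levi b I) φ) (n + 1)),
        rootSub α :=
  eq_iSup_rootSub (fun h x hx => cartan_lie_mem_prolongationNonneg
      (fun h x hx => hφ.cartan_lie_mem_annihilator h hx) h _ x hx)
    (by positivity : ((n + 1 : ℕ) : ℤ) ≠ 0) (prolongationNonneg_le_grading annihilator_le_grading _)

/-- The conditions defining reduced roots are additive, and two roots of positive degree are never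
opposite, so no bracket falls into the Cartan subalgebra. -/
lemma lie_mem_prolongationNonneg [LieModule.IsIrreducible ℂ (levi b I) V]
    (hμ : IsDominant b I (-μ)) {m n : ℕ} {x y : 𝔤}
    (hx : x ∈ prolongationNonneg (grading b I) (annihilator (levi b I) φ) (m + 1))
    (hy : y ∈ prolongationNonneg (grading b I) (annihilator (levi b I) φ) (n + 1)) :
    ⁅x, y⁆ ∈ prolongationNonneg (grading b I) (annihilator (levi b I) φ) (m + n + 1 + 1) := by
  rw [hφ.prolongationNonneg_eq_iSup, iSup_subtype'] at hx hy
  refine lie_mem_of_mem_iSup (fun ⟨α, hα⟩ ⟨β, hβ⟩ x hx y hy => ?_) hx hy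
  replace hα := hφ.isReducedRoot_of_rootSub_le hμ hα
  replace hβ := hφ.isReducedRoot_of_rootSub_le hμ hβ
  by_cases h1 : ∃ γ, (rootSystem H).root γ = (rootSystem H).root α + (rootSystem H).root β
  · obtain ⟨γ, hγ⟩ := h1
    refine hφ.rootSub_le_prolongationNonneg ?_ (lie_mem_rootSub hγ hx hy)
    convert! hα.add hβ hγ using 1
    push_cast
    ring
  · push Not at h1
    rw [lie_eq_zero_of_add_ne (fun h0 => ?_) h1 hx hy]
    · exact Submodule.zero_mem _
    · have h2 := deg_neg (b := b) (S := I) (eq_neg_of_add_eq_zero_right h0)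
      rw [hα.1, hβ.1] at h2
      lia

lemma prolongationNonneg_eq_span [LieModule.IsIrreducible ℂ (levi b I) V]
    (hμ : IsDominant b I (-μ)) (n : ℕ) :
    prolongationNonneg (grading b I) (annihilator (levi b I) φ) (n + 1 + 1) =
      Submodule.span ℂ {z |
        ∃ x ∈ prolongationNonneg (grading b I) (annihilator (levi b I) φ) 1,
        ∃ y ∈ prolongationNonneg (grading b I) (annihilator (levi b I) φ) (n + 1), ⁅x, y⁆ = z} := by
  refine le_antisymm ?_ (Submodule.span_le.mpr ?_)
  · rw [hφ.prolongationNonneg_eq_iSup]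
    refine iSup₂_le fun α hα => ?_
    obtain ⟨β, γ, hβ, hγ, h⟩ := exists_root_eq_add_of_rootSub_le annihilator_le_grading hα
    exact rootSub_le_of_lie_mem h fun x hx y hy =>
      Submodule.subset_span ⟨x, hβ hx, y, hγ hy, rfl⟩
  · rintro _ ⟨x, hx, y, hy, rfl⟩
    have := hφ.lie_mem_prolongationNonneg hμ (m := 0) hx hy
    rwa [zero_add] at this

lemma lieSpan_eq_iSup [LieModule.IsIrreducible ℂ (levi b I) V] (hμ : IsDominant b I (-μ)) :
    (LieSubalgebra.lieSpan ℂ 𝔤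
      (prolongationNonneg (grading b I) (annihilator (levi b I) φ) 1 : Set 𝔤)).toSubmodule =
      ⨆ n : ℕ, prolongationNonneg (grading b I) (annihilator (levi b I) φ) (n + 1) := by
  refine le_antisymm ?_ (iSup_le fun n => ?_)
  · let L : LieSubalgebra ℂ 𝔤 :=
      { toSubmodule := ⨆ n : ℕ,
          prolongationNonneg (grading b I) (annihilator (levi b I) φ) (n + 1)
        lie_mem' := fun {x y} hx hy => lie_mem_of_mem_iSup
          (fun m n x hx y hy => Submodule.mem_iSup_of_mem (m + n + 1)
            (hφ.lie_mem_prolongationNonneg hμ hx hy)) hx hy }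
    exact LieSubalgebra.lieSpan_le (K := L).mpr fun x hx => Submodule.mem_iSup_of_mem 0 hx
  · induction n with
    | zero => exact LieSubalgebra.subset_lieSpan
    | succ n ih =>
      rw [hφ.prolongationNonneg_eq_span hμ, Submodule.span_le]
      rintro _ ⟨x, hx, y, hy, rfl⟩
      exact LieSubalgebra.lie_mem _ (LieSubalgebra.subset_lieSpan hx) (ih hy)

lemma mem_rootsOf_tanaka_iff [LieModule.IsIrreducible ℂ (levi b I) V]
    (hμ : IsDominant b I (-μ)) {j : ℕ} (hj : 1 ≤ j) {α : H.root} :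
    α ∈ rootsOf H (tanaka b I φ j) ↔ IsReducedRoot b I μ j α := by
  obtain ⟨n, rfl⟩ : ∃ n, j = n + 1 := ⟨j - 1, by lia⟩
  exact hφ.rootSub_le_prolongationNonneg_iff hμ

end IsLowestWeightVector

end Generation

/-! ### Connected supports and comparison with the reduced geometry. -/

section ReducedGeometry

variable {b : SimpleRoots H} {I : Finset b.support} {μ : Dual ℂ H}

/-- If k were joined to no node of the support, then ⟨α, α_k^∨⟩ = 0, and reflecting α + α_k would
make α - α_k a root with coefficients of both signs. -/
lemma exists_dynkinGraph_adj {α γ : H.root} (hα : b.IsPos α) {k : b.support}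
    (hγ : (rootSystem H).root γ = (rootSystem H).root α + (rootSystem H).root k)
    (hk : b.coeff α k = 0) : ∃ l, b.coeff α l ≠ 0 ∧ (dynkinGraph b).Adj k l := by
  classical
  by_contra! hcon
  have hpair : (rootSystem H).pairingIn ℤ α k = 0 := by
    rw [RootPairing.Base.pairingIn_eq_sum (fun l : b.support => (l : H.root)) _
      (b.root_eq_sum_coeff α) k]
    refine Finset.sum_eq_zero fun l _ => ?_
    by_cases hl : b.coeff α l = 0
    · rw [hl, zero_mul]
    · have h1 : k ≠ l := by rintro rfl; exact hl hk
      have h2 : b.cartanMatrix k l * b.cartanMatrix l k = 0 := by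
        by_contra h
        exact hcon l hl ⟨h1, h⟩
      have h3 : b.cartanMatrix l k = 0 := by
        rcases mul_eq_zero.mp h2 with h | h
        · exact b.cartanMatrix_apply_eq_zero_iff_symm.mp h
        · exact h
      exact mul_eq_zero_of_right _ h3
  have hpairγ : (rootSystem H).pairingIn ℤ γ k = 2 := by
    apply FaithfulSMul.algebraMap_injective ℤ ℂ
    rw [RootPairing.algebraMap_pairingIn, ← RootPairing.root_coroot_eq_pairing, hγ, map_add,
      LinearMap.add_apply, RootPairing.root_coroot_eq_pairing, RootPairing.root_coroot_eq_pairing,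
      ← (rootSystem H).algebraMap_pairingIn ℤ, hpair, RootPairing.pairing_same]
    simp
  have hε : (rootSystem H).root ((rootSystem H).reflectionPerm k γ) =
      (rootSystem H).root α + (rootSystem H).root (negRoot (k : H.root)) := by
    rw [RootPairing.root_reflectionPerm, RootPairing.reflection_apply_root' ℤ, hpairγ, hγ,
      root_negRoot]
    module
  have hcoeff := RootPairing.Base.coeff_add (b := b) hε
  rw [RootPairing.Base.coeff_neg (root_negRoot (k : H.root)), b.coeff_of_support k] at hcoeff
  obtain ⟨l, hl⟩ := b.exists_coeff_ne_zero α
  have hlk : l ≠ k := by rintro rfl; exact hl hk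
  have h1 := congrFun hcoeff l
  have h2 := congrFun hcoeff k
  rw [Pi.add_apply, Pi.neg_apply, Pi.single_eq_of_ne hlk] at h1
  rw [Pi.add_apply, Pi.neg_apply, Pi.single_eq_same, hk] at h2
  have h3 := hα.coeff_nonneg l
  rcases b.coeff_nonneg_or_nonpos ((rootSystem H).reflectionPerm k γ) with h | h
  · have := h k
    lia
  · have := h l
    lia

/-- The support of a root is connected in the Dynkin diagram. -/
lemma reachable_of_coeff_ne_zero {α : H.root} (hα : b.IsPos α) {K : Set b.support}
    (hK : ∀ i, b.coeff α i ≠ 0 → i ∈ K) {i k : b.support} (hi : b.coeff α i ≠ 0)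
    (hk : b.coeff α k ≠ 0) :
    ((dynkinGraph b).induce K).Reachable ⟨i, hK i hi⟩ ⟨k, hK k hk⟩ := by
  classical
  suffices b.IsPos α ∧ ∀ (hK : ∀ i, b.coeff α i ≠ 0 → i ∈ K) (i k : b.support)
      (hi : b.coeff α i ≠ 0) (hk : b.coeff α k ≠ 0),
      ((dynkinGraph b).induce K).Reachable ⟨i, hK i hi⟩ ⟨k, hK k hk⟩ from this.2 hK i k hi hk
  refine hα.induction_on_add (p := fun α => b.IsPos α ∧ ∀ (hK : ∀ i, b.coeff α i ≠ 0 → i ∈ K)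
    (i k : b.support) (hi : b.coeff α i ≠ 0) (hk : b.coeff α k ≠ 0),
      ((dynkinGraph b).induce K).Reachable ⟨i, hK i hi⟩ ⟨k, hK k hk⟩) ?_ ?_
  · refine fun j hj => ⟨RootPairing.Base.isPos_of_mem_support hj, fun hK i k hi hk => ?_⟩
    have h (l : b.support) (hl : b.coeff j l ≠ 0) : l = ⟨j, hj⟩ := by
      by_contra hne
      exact hl ((congrFun (b.coeff_of_support ⟨j, hj⟩) l).trans (Pi.single_eq_of_ne hne 1))
    obtain rfl := (h i hi).trans (h k hk).symm
    exact SimpleGraph.Reachable.refl _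
  · intro α j γ hγ ⟨hα, ih⟩ hj
    refine ⟨hα.add (RootPairing.Base.isPos_of_mem_support hj) hγ, fun hK => ?_⟩
    have hadd (l : b.support) :
        b.coeff γ l = b.coeff α l + (Pi.single ⟨j, hj⟩ 1 : b.support → ℤ) l := by
      rw [RootPairing.Base.coeff_add hγ, Pi.add_apply, ← b.coeff_of_support ⟨j, hj⟩]
    have hKα (l : b.support) (hl : b.coeff α l ≠ 0) : b.coeff γ l ≠ 0 := by
      have h1 := hadd l
      have h2 := hα.coeff_nonneg l
      have h3 : 0 ≤ (Pi.single ⟨j, hj⟩ 1 : b.support → ℤ) l :=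
        (Pi.single_nonneg.mpr zero_le_one : (0 : b.support → ℤ) ≤ Pi.single ⟨j, hj⟩ 1) l
      lia
    have hjγ : b.coeff γ ⟨j, hj⟩ ≠ 0 := by
      have h1 := hadd ⟨j, hj⟩
      have h2 := hα.coeff_nonneg ⟨j, hj⟩
      rw [Pi.single_eq_same] at h1
      lia
    have hKα' := fun l hl => hK l (hKα l hl)
    -- The added node is already in the support of α or is adjacent to it.
    obtain ⟨l, hl, hjl⟩ : ∃ (l : b.support) (hl : b.coeff α l ≠ 0),
        ((dynkinGraph b).induce K).Reachable ⟨⟨j, hj⟩, hK _ hjγ⟩ ⟨l, hKα' l hl⟩ := by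
      by_cases hjα : b.coeff α ⟨j, hj⟩ = 0
      · obtain ⟨l, hl, hadj⟩ := exists_dynkinGraph_adj (k := ⟨j, hj⟩) hα hγ hjα
        exact ⟨l, hl, SimpleGraph.Adj.reachable (G := (dynkinGraph b).induce K) hadj⟩
      · exact ⟨_, hjα, SimpleGraph.Reachable.refl _⟩
    have key (i : b.support) (hi : b.coeff γ i ≠ 0) :
        ((dynkinGraph b).induce K).Reachable ⟨i, hK i hi⟩ ⟨l, hKα' l hl⟩ := by
      by_cases hij : i = ⟨j, hj⟩
      · subst hij
        exact hjl
      · have h1 := hadd i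
        rw [Pi.single_eq_of_ne hij, add_zero] at h1
        exact ih hKα' i l (h1 ▸ hi) hl
    exact fun i k hi hk => (key i hi).trans (key k hk).symm

lemma Imu_subset_keptNodes {i : b.support} (hi : i ∈ Imu b I μ) : i ∈ keptNodes b I μ :=
  ⟨fun h => h.2 hi, fun h => (mem_Jmu.mp h).1 (mem_Imu.mp hi).1⟩

lemma Imu_subset_reducedNodes {i : b.support} (hi : i ∈ Imu b I μ) : i ∈ reducedNodes b I μ :=
  ⟨Imu_subset_keptNodes hi, i, Imu_subset_keptNodes hi, hi, SimpleGraph.Reachable.refl _⟩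

/-- The support of a reduced root consists of nodes of the reduced diagram. -/
lemma IsReducedRoot.mem_reducedNodes {j : ℤ} (hj : 0 < j) {α : H.root}
    (hα : IsReducedRoot b I μ j α) {i : b.support} (hi : b.coeff α i ≠ 0) :
    i ∈ reducedNodes b I μ := by
  have hpos : b.IsPos α := isPos_of_deg_pos (S := I) (by rw [hα.1]; exact hj)
  have hK (k : b.support) (hk : b.coeff α k ≠ 0) : k ∈ keptNodes b I μ :=
    ⟨fun h => hk (coeff_eq_zero_of_deg_eq Imu_subset hpos (hα.2.1.trans hα.1.symm) h.1 h.2),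
      fun h => hk ((deg_eq_zero_iff hpos).mp hα.2.2 k h)⟩
  obtain ⟨k, hkI, hk⟩ : ∃ k ∈ Imu b I μ, b.coeff α k ≠ 0 := by
    by_contra! h
    have h1 := (deg_eq_zero_iff hpos).mpr h
    rw [hα.2.1] at h1
    exact hj.ne' h1
  exact ⟨hK i hi, k, hK k hk, hkI, reachable_of_coeff_ne_zero hpos hK hi hk⟩

/-- A root of degree `j` for `I_μ` whose support lies in the reduced diagram is reduced. -/
lemma isReducedRoot_of_forall_notMem {j : ℤ} {α : H.root} (hα : deg b (Imu b I μ) α = j)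
    (h : ∀ i ∉ reducedNodes b I μ, b.coeff α i = 0) : IsReducedRoot b I μ j α := by
  refine ⟨?_, hα, Finset.sum_eq_zero fun i hi => h i fun ⟨hK, _⟩ => hK.2 hi⟩
  rw [← hα]
  exact (Finset.sum_subset Imu_subset fun i hi hi' => h i fun ⟨hK, _⟩ => hK.1 ⟨hi, hi'⟩).symm

variable {𝔤' : Type*} [LieRing 𝔤'] [LieAlgebra ℂ 𝔤'] [FiniteDimensional ℂ 𝔤']
  [LieAlgebra.IsSemisimple ℂ 𝔤'] {H' : LieSubalgebra ℂ 𝔤'} [H'.IsCartanSubalgebra]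
  {b' : SimpleRoots H'} {p' : LieSubalgebra ℂ 𝔤'} {e : b'.support ≃ reducedNodes b I μ}

/-- Reduced roots correspond to the roots of positive degree of the reduced geometry. -/
lemma IsReducedGeometry.exists_isReducedRoot_iff (h : IsReducedGeometry b I μ b' p' e) {j : ℤ}
    (hj : 0 < j) (m : b.support → ℤ) :
    (∃ α, IsReducedRoot b I μ j α ∧
        (rootSystem H).root α = ∑ i, m i • (rootSystem H).root (i : H.root)) ↔
      (∀ i, i ∉ reducedNodes b I μ → m i = 0) ∧
        ∃ α' ∈ rootsOf H' (grading b' (crossed b' p') j),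
          (rootSystem H').root α' = ∑ i, m (e i).1 • (rootSystem H').root (i : H'.root) := by
  have hinj : Function.Injective fun i => (e i).1 := Subtype.val_injective.comp e.injective
  have hdeg : ∑ i ∈ crossed b' p', m (e i).1 = ∑ i ∈ Imu b I μ, m i := by
    refine Finset.sum_bij (fun i _ => (e i).1) (fun i hi => (h.crossed_iff i).mp hi)
      (fun i _ k _ hik => hinj hik) (fun k hk => ?_) fun _ _ => rfl
    refine ⟨e.symm ⟨k, Imu_subset_reducedNodes hk⟩, (h.crossed_iff _).mpr ?_, ?_⟩ <;> simp [hk]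
  have hsum (hm : ∀ i, i ∉ reducedNodes b I μ → m i = 0) :
      ∑ k, m (e k).1 • (rootSystem H).root (e k).1 =
        ∑ i, m i • (rootSystem H).root (i : H.root) :=
    Fintype.sum_of_injective _ hinj _ _ (fun i hi => by
      rw [hm i fun hi' => hi ⟨e.symm ⟨i, hi'⟩, by simp⟩, zero_smul]) fun _ => rfl
  constructor
  · rintro ⟨α, hα, hαm⟩
    have hcoeff := RootPairing.Base.coeff_eq_of_root_eq_sum hαm
    have hm (i) (hi : i ∉ reducedNodes b I μ) : m i = 0 := by
      rw [← hcoeff]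
      by_contra h0
      exact hi (hα.mem_reducedNodes hj h0)
    have hpos : b.IsPos α := isPos_of_deg_pos (S := I) (by rw [hα.1]; exact hj)
    obtain ⟨α', hα'⟩ := hpos.exists_root_eq_sum_of_cartanMatrix_eq b' (fun i => (e i).1) hinj id
      (fun i k => (h.cartanMatrix_eq i k).symm) (fun i => m (e i).1) (by rw [hsum hm, hαm])
    refine ⟨hm, α', rootSub_le_grading_iff.mpr ?_, hα'⟩
    have hα'' := RootPairing.Base.coeff_eq_of_root_eq_sum (b := b') hα'
    rw [deg, hα'', hdeg, ← hα.2.1, deg, hcoeff]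
  · rintro ⟨hm, α', hdegα', hα'⟩
    have hd := rootSub_le_grading_iff.mp hdegα'
    have hpos : b'.IsPos α' := isPos_of_deg_pos (S := crossed b' p') (by rw [hd]; exact hj)
    -- The same transport with the two root systems exchanged: the full base of 𝔤' now maps into a
    -- part of the base of 𝔤.
    obtain ⟨α, hα⟩ := hpos.exists_root_eq_sum_of_cartanMatrix_eq b id Function.injective_id
      (fun i => (e i).1) h.cartanMatrix_eq (fun i => m (e i).1) hα'
    rw [hsum hm] at hα
    have hcoeff := RootPairing.Base.coeff_eq_of_root_eq_sum hα
    have hcoeff' := RootPairing.Base.coeff_eq_of_root_eq_sum hα'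
    refine ⟨α, isReducedRoot_of_forall_notMem ?_ (by rwa [hcoeff]), hα⟩
    rw [deg, hcoeff, ← hdeg, ← hd, deg, hcoeff']

end ReducedGeometry

end

end ParabolicProlongation

/-! ### The main theorem. -/

open LieAlgebra LieAlgebra.IsKilling Module ParabolicProlongation
theorem theorem3p4
    {𝔤 : Type*} [LieRing 𝔤] [LieAlgebra ℂ 𝔤] [FiniteDimensional ℂ 𝔤]
    [LieAlgebra.IsSemisimple ℂ 𝔤]
    {H : LieSubalgebra ℂ 𝔤} [H.IsCartanSubalgebra] (b : SimpleRoots H)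
    (p : LieSubalgebra ℂ 𝔤) (hp : borel b ≤ p.toSubmodule)
    (I : Finset b.support) (hI : I = crossed b p)
    (μ : Dual ℂ H) (hμ : IsDominant b I (-μ)) (hIμ : (Imu b I μ).Nonempty)
    {V : Type*} [AddCommGroup V] [Module ℂ V] [LieRingModule (levi b I) V]
    [LieModule ℂ (levi b I) V] [LieModule.IsIrreducible ℂ (levi b I) V]
    (φ : V) (hφ : IsLowestWeightVector b I μ φ)
    (a : ℤ → Submodule ℂ 𝔤) (ha : a = tanaka b I φ) :
    -- `𝔞_1` generates all `𝔞_j`, `j ≥ 1`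
    (∀ j : ℕ, 1 ≤ j →
      a (j + 1) = Submodule.span ℂ {z | ∃ x ∈ a 1, ∃ y ∈ a j, ⁅x, y⁆ = z}) ∧
    (LieSubalgebra.lieSpan ℂ 𝔤 (a 1 : Set 𝔤)).toSubmodule = ⨆ (j : ℕ) (_ : 1 ≤ j), a j ∧
    -- `𝔞_j` is the sum of the root spaces it contains, and `Δ(𝔞_j)` is as claimed
    (∀ j : ℕ, 1 ≤ j →
      a j = ⨆ α ∈ rootsOf H (a j), rootSub α ∧
      rootsOf H (a j) = {α | α ∈ rootsOf H (grading b I j) ∧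
        α.1 (Z b (Imu b I μ)) = (j : ℂ) ∧ α.1 (Z b (Jmu b I μ)) = 0}) ∧
    -- `Δ(𝔞_j)` corresponds to the roots of degree `j` of the reduced geometry
    (∀ {𝔤' : Type*} [LieRing 𝔤'] [LieAlgebra ℂ 𝔤'] [FiniteDimensional ℂ 𝔤']
        [LieAlgebra.IsSemisimple ℂ 𝔤'] {H' : LieSubalgebra ℂ 𝔤'} [H'.IsCartanSubalgebra]
        (b' : SimpleRoots H') (p' : LieSubalgebra ℂ 𝔤') (e : b'.support ≃ reducedNodes b I μ),
        IsReducedGeometry b I μ b' p' e →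
        ∀ (j : ℕ), 1 ≤ j → ∀ m : b.support → ℤ,
          (∃ α ∈ rootsOf H (a j),
            (rootSystem H).root α = ∑ i, m i • (rootSystem H).root (i : H.root)) ↔
          ((∀ i, i ∉ reducedNodes b I μ → m i = 0) ∧
            ∃ α' ∈ rootsOf H' (grading b' (crossed b' p') j),
              (rootSystem H').root α' =
                ∑ i, m (e i).1 • (rootSystem H').root (i : H'.root))) := by
  subst ha
  refine ⟨fun j hj => ?_, ?_, fun j hj => ⟨?_, ?_⟩, ?_⟩
  · obtain ⟨n, rfl⟩ : ∃ n, j = n + 1 := ⟨j - 1, by lia⟩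
    exact hφ.prolongationNonneg_eq_span hμ n
  · rw [tanaka_one, hφ.lieSpan_eq_iSup hμ]
    refine le_antisymm (iSup_le fun n => le_iSup₂_of_le (n + 1) (by lia) le_rfl)
      (iSup₂_le fun j hj => ?_)
    obtain ⟨n, rfl⟩ : ∃ n, j = n + 1 := ⟨j - 1, by lia⟩
    exact le_iSup_of_le n le_rfl
  · obtain ⟨n, rfl⟩ : ∃ n, j = n + 1 := ⟨j - 1, by lia⟩
    exact hφ.prolongationNonneg_eq_iSup n
  · ext α
    rw [hφ.mem_rootsOf_tanaka_iff hμ hj]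
    refine and_congr rootSub_le_grading_iff.symm (and_congr ?_ ?_) <;>
      rw [root_apply_Z] <;> norm_cast
  · intro 𝔤' _ _ _ _ H' _ b' p' e h j hj m
    rw [← h.exists_isReducedRoot_iff (by exact_mod_cast hj) m]
    exact exists_congr fun α => and_congr_left' (hφ.mem_rootsOf_tanaka_iff hμ hj)
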